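/- Conventions. Work in $\mathbb R^n$ with the Euclidean norm $|\cdot|$; functions given on a subset of $\mathbb R^n$ are extended by $0$, and $\mathrm{Supp}(f)=\{x: f(x)\neq 0\}$. For non-negative $f,g$ with finite positive integrals, a Borel map $T:\overline{\mathrm{Supp}(f)}\to\overline{\mathrm{Supp}(g)}$ is a *transportation map from $f$ to $g$* if $\frac1{\int g}\int_A g=\frac1{\int f}\int_{T^{-1}(A)}f$ for every measurable $A\subseteq \mathrm{Supp}(g)$. It is a *Knothe map* if moreover, for each $i$, the coordinate $T(x)_i$ depends only on $x_1,\dots,x_i$ and is strictly increasing in $x_i$ for fixed $x_1,\dots,x_{i-1}$. Put $$S_T\{g,f\}(x)=f(x)\log\frac{g(T(x))}{f(x)}-\nabla f(x)\cdot(T(x)-x)$$ (defined for almost every $x\in\mathrm{Supp}(f)$ if $f$ is differentiable almost everywhere there), and $$\mathrm{Tire}(g\,\|\,f)=\sup_T\Big[\int_{\mathrm{Supp}(f)}S_T\{g,f\}-\Big(\int f\Big)\log\frac{\int g}{\int f}\Big],$$ where the supremum is over all transportation maps $T$ from $f$ to $g$ for which the integral of $S_T\{g,f\}$ is well defined as an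 element of $[-\infty,+\infty]$. Theorem. Let $R\ge 1$ and let $Q\subset\mathbb R^n$ be a unit cube parallel to the axes, i.e. a translate of $(0,1)^n$ or of its closure. Let $f:Q\to(0,\infty)$ be a Lipschitz function such that $$f(\lambda x+(1-\lambda)y)\le R\,[\lambda f(x)+(1-\lambda)f(y)]$$ for all $0<\lambda<1$ and all $x,y\in Q$ for which $x-y$ is proportional to a standard unit vector, and let $g:Q\to(0,\infty)$ be integrable. Then there exists a transportation map $T$ from $f$ to $g$, which is a Knothe map, such that $\int_Q S_T\{g,f\}$ is well defined in $[-\infty,+\infty]$ and $$\int_Q|T(x)-x|^2f(x)\,dx\;\le\;\frac{40}{9}R^2\Big[\int_Q S_T\{g,f\}-\Big(\int_Q f\Big)\log\frac{\int_Q g}{\int_Q f}\Big]\;\le\;\frac{40}{9}R^2\cdot \mathrm{Tire}(g\,\|\,f),$$ as inequalities in $[-\infty,+\infty]$. -/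

import Mathlib

open MeasureTheory Set

noncomputable section

/-- `Q` is a unit cube in `ℝⁿ` parallel to the axes: a translate of `(0, 1)ⁿ` or of its closure. -/
def IsUnitCube {n : ℕ} (Q : Set (EuclideanSpace ℝ (Fin n))) : Prop :=
  ∃ a : Fin n → ℝ,
    Q = {x | ∀ i, a i < x i ∧ x i < a i + 1} ∨ Q = {x | ∀ i, a i ≤ x i ∧ x i ≤ a i + 1}

/-- `f (t x + (1 - t) y) ≤ R (t f(x) + (1 - t) f(y))` for all `x, y ∈ Q` whose difference is
proportional to a standard unit vector, and all `0 < t < 1`. -/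
def IsApproxConvexAlongAxes {n : ℕ} (R : ℝ) (Q : Set (EuclideanSpace ℝ (Fin n)))
    (f : EuclideanSpace ℝ (Fin n) → ℝ) : Prop :=
  ∀ x ∈ Q, ∀ y ∈ Q, (∃ (i : Fin n) (c : ℝ), x - y = EuclideanSpace.single i c) →
    ∀ t : ℝ, 0 < t → t < 1 → f (t • x + (1 - t) • y) ≤ R * (t * f x + (1 - t) * f y)

/-- `S_y{g, f}(x) = f(x) log (g(y) / f(x)) - ∇f(x) · (y - x)`;
the Fréchet derivative applied to `y - x` is `∇f(x) · (y - x)`. -/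
def pointS {n : ℕ} (g f : EuclideanSpace ℝ (Fin n) → ℝ) (y x : EuclideanSpace ℝ (Fin n)) : ℝ :=
  f x * Real.log (g y / f x) - fderiv ℝ f x (y - x)

/-- `S_T{g, f}(x) = S_{T(x)}{g, f}(x)`. -/
def mapS {n : ℕ} (g f : EuclideanSpace ℝ (Fin n) → ℝ)
    (T : EuclideanSpace ℝ (Fin n) → EuclideanSpace ℝ (Fin n)) (x : EuclideanSpace ℝ (Fin n)) : ℝ :=
  pointS g f (T x) x

/-- The integral of `φ` over `s` is well defined as an element of `[-∞, +∞]`: `φ` is measurable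
(up to a null set) and the integrals of its positive and negative parts are not both infinite. -/
def IntegralWellDefined {n : ℕ} (s : Set (EuclideanSpace ℝ (Fin n)))
    (φ : EuclideanSpace ℝ (Fin n) → ℝ) : Prop :=
  AEMeasurable φ (volume.restrict s) ∧
    ((∫⁻ x in s, ENNReal.ofReal (φ x)) ≠ ⊤ ∨ (∫⁻ x in s, ENNReal.ofReal (-φ x)) ≠ ⊤)

/-- The `[-∞, +∞]`-valued Lebesgue integral `∫_s φ = ∫_s φ⁺ - ∫_s φ⁻`
(meaningful when `IntegralWellDefined s φ`). -/
def extIntegral {n : ℕ} (s : Set (EuclideanSpace ℝ (Fin n)))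
    (φ : EuclideanSpace ℝ (Fin n) → ℝ) : EReal :=
  ((∫⁻ x in s, ENNReal.ofReal (φ x) : ENNReal) : EReal) -
    ((∫⁻ x in s, ENNReal.ofReal (-φ x) : ENNReal) : EReal)

/-- `T` is a transportation map from `f` to `g`: a Borel map from the closure of
`Supp f = {f ≠ 0}` to the closure of `Supp g` that pushes the probability measure with density
proportional to `f` forward to the one with density proportional to `g`.
Only the values of `T` on the closure of `Supp f` matter; any Borel map defined there extends to a
Borel map of the whole space. -/
def IsTransportMap {n : ℕ} (f g : EuclideanSpace ℝ (Fin n) → ℝ)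
    (T : EuclideanSpace ℝ (Fin n) → EuclideanSpace ℝ (Fin n)) : Prop :=
  Measurable T ∧
  MapsTo T (closure (Function.support f)) (closure (Function.support g)) ∧
  ∀ A : Set (EuclideanSpace ℝ (Fin n)), MeasurableSet A → A ⊆ Function.support g →
    (∫ y, g y)⁻¹ * ∫ y in A, g y =
      (∫ x, f x)⁻¹ * ∫ x in closure (Function.support f) ∩ T ⁻¹' A, f x

/-- `T` is a Knothe map from `f` to `g`: a transportation map that is triangular (`T(x)ᵢ` depends
only on `x₁, …, xᵢ`) and such that `T(x)ᵢ` is strictly increasing in `xᵢ` when `x₁, …, xᵢ₋₁` are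
fixed. -/
def IsKnotheMap {n : ℕ} (f g : EuclideanSpace ℝ (Fin n) → ℝ)
    (T : EuclideanSpace ℝ (Fin n) → EuclideanSpace ℝ (Fin n)) : Prop :=
  IsTransportMap f g T ∧
  ∀ x ∈ closure (Function.support f), ∀ x' ∈ closure (Function.support f), ∀ i : Fin n,
    (∀ j < i, x j = x' j) →
      (x i = x' i → T x i = T x' i) ∧ (x i < x' i → T x i < T x' i)

/-- `Tire(g ‖ f)`: the supremum, over all transportation maps `T` from `f` to `g` for which the
integral of `S_T{g, f}` is well defined, of `∫_{Supp f} S_T{g, f} - (∫ f) log (∫ g / ∫ f)`. -/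
def Tire {n : ℕ} (g f : EuclideanSpace ℝ (Fin n) → ℝ) : EReal :=
  ⨆ (T : EuclideanSpace ℝ (Fin n) → EuclideanSpace ℝ (Fin n))
    (_ : IsTransportMap f g T ∧ IntegralWellDefined (Function.support f) (mapS g f T)),
    extIntegral (Function.support f) (mapS g f T) -
      (((∫ x, f x) * Real.log ((∫ x, g x) / ∫ x, f x) : ℝ) : EReal)

end

/-!
The map `T` is the Knothe map: coordinate `i` at `x` is the monotone transport from the conditional
law of coordinate `i` under `f`, given `x₁, …, xᵢ₋₁`, to the conditional law under `g`, given
`T(x)₁, …, T(x)ᵢ₋₁` (`knothe`, `lintegral_knothe`). Since `g` is positive, `Tᵢ` is absolutely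
continuous along every line parallel to axis `i`, with an explicit derivative `τᵢ`, a quotient of
conditional densities (`lintegral_div_monoTransport`, `knothe_eq_integral`). The product of the
`τᵢ` telescopes over the marginals to `(f / ∫ f) · (∫ g / g ∘ T)` (`ae_sum_log_knotheDeriv`), so
that, with `φ(τ) = τ - 1 - log τ ≥ 0`,
`S_T{g, f} = f log (∫ g / ∫ f) + ∑ᵢ f φ(τᵢ) - ∑ᵢ [∂ᵢf (Tᵢ - xᵢ) + f (τᵢ - 1)]` almost everywhere
(`ae_mapS_eq`). Each summand of the last sum is integrable and, by integration by parts on lines,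
has zero integral (`integral_divergence`), because `Tᵢ` fixes the end points of each line. Hence the
negative part of `S_T` is integrable and `∫ S_T - (∫ f) log (∫ g / ∫ f) = ∑ᵢ ∫ f φ(τᵢ)` in
`[0, ∞]`.

It remains to prove `∫ p u² ≤ 4 R² ∫ p φ(τ)` on a unit interval for `u = T - x`, `τ = 1 + u'`, and
a weight `p` that is convex up to the factor `R` (`lintegral_displacement_sq_le`); then
`4 ≤ 40 / 9` concludes. The trapezoid rule `∫ₛᵗ p ≤ (R / 2) (p(s) + p(t))` implies that some
primitive `P` of `p` satisfies `|P| ≤ (R / 2) p` (`exists_abs_primitive_sub_le`). Integrating by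
parts against `w = u²`, which vanishes at the end points, gives
`∫ p u² ≤ (R / 2) ∫ p |w'| = R ∫ p |u| |τ - 1|`, and the Young inequality
`R |u| |τ - 1| ≤ 2 R² φ(τ) + u² / 2`, valid as `|u| ≤ 1 ≤ R` (`mul_abs_mul_abs_le`), lets half of
the left-hand side be absorbed.
-/

/-! ### One-dimensional weighted inequalities -/

/-- Trapezoid rule for a function that is convex up to a factor `R`. -/
lemma integral_le_trapezoid {p : ℝ → ℝ} {R s t : ℝ} (hp : Continuous p) (hst : s < t)
    (hconv : ∀ l : ℝ, 0 < l → l < 1 → p (l * s + (1 - l) * t) ≤ R * (l * p s + (1 - l) * p t)) :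
    ∫ v in s..t, p v ≤ (t - s) * (R / 2 * (p s + p t)) := by
  have hts : 0 < t - s := sub_pos.2 hst
  have key : ∫ l in (0 : ℝ)..1, p ((s - t) * l + t) ≤
      ∫ l in (0 : ℝ)..1, R * (l * p s + (1 - l) * p t) := by
    apply intervalIntegral.integral_mono_on_of_le_Ioo zero_le_one
    · exact (hp.comp (by fun_prop)).intervalIntegrable _ _
    · exact Continuous.intervalIntegrable (by fun_prop) _ _
    · intro l hl
      have := hconv l hl.1 hl.2
      rwa [show l * s + (1 - l) * t = (s - t) * l + t by ring] at this
  have h1 : ∫ l in (0 : ℝ)..1, R * (l * p s + (1 - l) * p t) = R / 2 * (p s + p t) := by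
    have : ∀ l : ℝ, R * (l * p s + (1 - l) * p t) = R * (p s - p t) * l + R * p t := by
      intro l; ring
    simp_rw [this]
    rw [intervalIntegral.integral_add (Continuous.intervalIntegrable (by fun_prop) _ _)
      (by simp), intervalIntegral.integral_const_mul, integral_id]
    simp
    ring
  have h2 : ∫ l in (0 : ℝ)..1, p ((s - t) * l + t) = (t - s)⁻¹ * ∫ v in s..t, p v := by
    rw [intervalIntegral.integral_comp_mul_add _ (sub_ne_zero.2 hst.ne)]
    rw [intervalIntegral.integral_symm]
    simp only [mul_zero, zero_add, mul_one, sub_add_cancel, smul_eq_mul]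
    rw [← neg_sub t s, inv_neg]
    ring
  rw [h1, h2, inv_mul_le_iff₀ hts] at key
  exact key

/-- By the trapezoid rule, some primitive of a weight that is convex up to a factor `R` is bounded
in absolute value by `R / 2` times the weight. -/
lemma exists_abs_primitive_sub_le {p : ℝ → ℝ} {R a : ℝ} (hR : 0 ≤ R) (hp : Continuous p)
    (hpos : ∀ t ∈ Ioo a (a + 1), 0 ≤ p t)
    (hconv : ∀ s ∈ Ioo a (a + 1), ∀ t ∈ Ioo a (a + 1), ∀ l : ℝ, 0 < l → l < 1 →
      p (l * s + (1 - l) * t) ≤ R * (l * p s + (1 - l) * p t)) :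
    ∃ c : ℝ, ∀ s ∈ Ioo a (a + 1), |(∫ v in a..s, p v) - c| ≤ R / 2 * p s := by
  set P : ℝ → ℝ := fun s => ∫ v in a..s, p v
  have hii : ∀ s t, IntervalIntegrable p volume s t := fun s t => hp.intervalIntegrable _ _
  have key : ∀ s ∈ Ioo a (a + 1), ∀ t ∈ Ioo a (a + 1), P s - R / 2 * p s ≤ P t + R / 2 * p t := by
    intro s hs t ht
    have hPs : P s - P t = ∫ v in t..s, p v :=
      intervalIntegral.integral_interval_sub_left (hii _ _) (hii _ _)
    have h0 : 0 ≤ R / 2 * p s := by have := hpos s hs; positivity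
    have h1 : 0 ≤ R / 2 * p t := by have := hpos t ht; positivity
    have hle : ∫ v in t..s, p v ≤ R / 2 * (p t + p s) := by
      rcases lt_or_ge t s with h | h
      · refine (integral_le_trapezoid hp h (hconv t ht s hs)).trans ?_
        have : s - t ≤ 1 := by linarith [hs.2, ht.1]
        nlinarith
      · rw [intervalIntegral.integral_symm]
        have : 0 ≤ ∫ v in s..t, p v := intervalIntegral.integral_nonneg h fun u hu =>
          hpos u ⟨hs.1.trans_le hu.1, hu.2.trans_lt ht.2⟩
        nlinarith
    linarith
  have hmid : a + 1 / 2 ∈ Ioo a (a + 1) := by constructor <;> linarith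
  refine ⟨sSup ((fun s => P s - R / 2 * p s) '' Ioo a (a + 1)), fun s hs => ?_⟩
  have h1 : P s - R / 2 * p s ≤ sSup ((fun s => P s - R / 2 * p s) '' Ioo a (a + 1)) := by
    refine le_csSup ⟨P s + R / 2 * p s, ?_⟩ ⟨s, hs, rfl⟩
    rintro _ ⟨t, ht, rfl⟩
    exact key t ht s hs
  have h2 : sSup ((fun s => P s - R / 2 * p s) '' Ioo a (a + 1)) ≤ P s + R / 2 * p s := by
    refine csSup_le ⟨_, _, hmid, rfl⟩ ?_
    rintro _ ⟨t, ht, rfl⟩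
    exact key t ht s hs
  rw [abs_le]
  constructor <;> linarith

/-- Weighted Cheeger inequality on a unit interval with Dirichlet boundary conditions. -/
lemma integral_mul_le_integral_mul_abs_deriv {p w : ℝ → ℝ} {R a : ℝ} (hR : 0 ≤ R)
    (hp : Continuous p) (hpos : ∀ t ∈ Ioo a (a + 1), 0 ≤ p t)
    (hconv : ∀ s ∈ Ioo a (a + 1), ∀ t ∈ Ioo a (a + 1), ∀ l : ℝ, 0 < l → l < 1 →
      p (l * s + (1 - l) * t) ≤ R * (l * p s + (1 - l) * p t))
    (hw : AbsolutelyContinuousOnInterval w a (a + 1)) (hwa : w a = 0) (hwb : w (a + 1) = 0) :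
    ∫ t in a..(a + 1), p t * w t ≤ R / 2 * ∫ t in a..(a + 1), p t * |deriv w t| := by
  obtain ⟨c, hc⟩ := exists_abs_primitive_sub_le hR hp hpos hconv
  have hle : a ≤ a + 1 := by linarith
  set P : ℝ → ℝ := fun s => (∫ v in a..s, p v) - c with hP
  have hPd : ∀ s, HasDerivAt P (p s) s := fun s =>
    (intervalIntegral.integral_hasDerivAt_right (hp.intervalIntegrable _ _)
      (hp.stronglyMeasurableAtFilter _ _) hp.continuousAt).sub_const c
  have hPac : AbsolutelyContinuousOnInterval P a (a + 1) := by
    apply ContDiffOn.absolutelyContinuousOnInterval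
    apply ContDiff.contDiffOn
    rw [contDiff_one_iff_deriv]
    refine ⟨fun s => (hPd s).differentiableAt, ?_⟩
    rwa [show deriv P = p from funext fun s => (hPd s).deriv]
  have hibp := hPac.integral_mul_deriv_eq_deriv_mul hw
  simp only [hwa, hwb, mul_zero, sub_zero, zero_sub] at hibp
  have e1 : ∫ t in a..(a + 1), p t * w t = ∫ t in a..(a + 1), - (P t * deriv w t) := by
    rw [intervalIntegral.integral_neg, hibp, neg_neg]
    exact intervalIntegral.integral_congr fun t _ => by simp [(hPd t).deriv]
  have hPc : Continuous P := continuous_iff_continuousAt.2 fun s => (hPd s).continuousAt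
  have hwi := hw.intervalIntegrable_deriv
  rw [e1, ← intervalIntegral.integral_const_mul]
  apply intervalIntegral.integral_mono_on_of_le_Ioo hle
  · exact (hwi.continuousOn_mul hPc.continuousOn).neg
  · exact (hwi.abs.continuousOn_mul hp.continuousOn).const_mul _
  · intro t ht
    calc -(P t * deriv w t) ≤ |P t| * |deriv w t| := by
          rw [← abs_mul]; exact neg_le_abs _
      _ ≤ (R / 2 * p t) * |deriv w t| := by gcongr; exact hc t ht
      _ = _ := by ring

lemma neg_sub_sq_le_log_one_sub {s : ℝ} (hs : |s| ≤ 1 / 2) : -s - s ^ 2 ≤ Real.log (1 - s) := by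
  have h := Real.abs_log_sub_add_sum_range_le (x := s) (by linarith) 4
  have h2 : |s| ^ (4 + 1) / (1 - |s|) ≤ s ^ 2 / 4 := by
    rw [div_le_iff₀ (by linarith)]
    have h0 := abs_nonneg s
    have hsq : s ^ 2 = |s| ^ 2 := (sq_abs s).symm
    rw [hsq]
    have h3 : |s| ^ 3 ≤ (1 / 2) ^ 3 := by gcongr
    nlinarith [sq_nonneg |s|, mul_le_mul_of_nonneg_left h3 (sq_nonneg |s|)]
  have h3 := (abs_le.1 (h.trans h2)).1
  simp only [Finset.sum_range_succ, Finset.sum_range_zero] at h3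
  norm_num at h3
  obtain ⟨hl, hu⟩ := abs_le.1 hs
  nlinarith [mul_nonneg (sq_nonneg s) (by linarith : 0 ≤ 1 / 2 - s),
    mul_nonneg (sq_nonneg s) (mul_nonneg (by linarith : 0 ≤ 1 / 2 - s)
      (by linarith : 0 ≤ 1 / 2 + s))]

/-- A Young inequality: `v - log (1 + v)` and its conjugate `-s - log (1 - s)`, the latter bounded
by `s ^ 2` for `|s| ≤ 1 / 2`, evaluated at `v = τ - 1` and `s = ± u / (2 R)`. -/
lemma mul_abs_mul_abs_le {R u τ : ℝ} (hR : 1 ≤ R) (hu : |u| ≤ 1) (hτ : 0 < τ) :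
    R * (|u| * |τ - 1|) ≤ 2 * R ^ 2 * (τ - 1 - Real.log τ) + u ^ 2 / 2 := by
  have key : ∀ s : ℝ, |s| ≤ 1 / 2 → s * (τ - 1) ≤ (τ - 1 - Real.log τ) + s ^ 2 := by
    intro s hs
    have h1 : 0 < 1 - s := by linarith [(abs_le.1 hs).2]
    have h2 := Real.log_le_sub_one_of_pos (mul_pos hτ h1)
    rw [Real.log_mul hτ.ne' h1.ne'] at h2
    nlinarith [neg_sub_sq_le_log_one_sub hs]
  have hR0 : 0 < R := by linarith
  obtain ⟨s, hs, hsq, hse⟩ : ∃ s : ℝ, |s| ≤ 1 / 2 ∧ 2 * R ^ 2 * s ^ 2 = u ^ 2 / 2 ∧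
      R * (|u| * |τ - 1|) = 2 * R ^ 2 * (s * (τ - 1)) := by
    have hb : |u| / (2 * R) ≤ 1 / 2 := by
      rw [div_le_iff₀ (by positivity)]; linarith
    have hb0 : 0 ≤ |u| / (2 * R) := by positivity
    rcases le_total 0 (τ - 1) with h | h
    · refine ⟨|u| / (2 * R), by rwa [abs_of_nonneg hb0], ?_, ?_⟩
      · rw [div_pow, sq_abs]; field_simp
      · rw [abs_of_nonneg h]; field_simp
    · refine ⟨-(|u| / (2 * R)), by rwa [abs_neg, abs_of_nonneg hb0], ?_, ?_⟩
      · rw [neg_sq, div_pow, sq_abs]; field_simp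
      · rw [abs_of_nonpos h]; field_simp
  rw [hse, ← hsq]
  have := key s hs
  nlinarith [mul_le_mul_of_nonneg_left this (by positivity : 0 ≤ 2 * R ^ 2)]

section Displacement

variable {a : ℝ} {p T τ : ℝ → ℝ}

/-- The displacement `T t - t` of a map with derivative `τ` fixing the end points of an interval is
absolutely continuous, vanishes at the end points and has derivative `τ - 1`; since `T` is only
controlled on the closed interval, the displacement is replaced by a primitive of `τ - 1`. -/
lemma exists_displacement (hτ : IntervalIntegrable τ volume a (a + 1))
    (hT : ∀ s ∈ Icc a (a + 1), T s = a + ∫ t in a..s, τ t) (hTb : T (a + 1) = a + 1) :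
    ∃ U : ℝ → ℝ, AbsolutelyContinuousOnInterval U a (a + 1) ∧ U a = 0 ∧ U (a + 1) = 0 ∧
      (∀ s ∈ Icc a (a + 1), U s = T s - s) ∧
      ∀ᵐ t, t ∈ Icc a (a + 1) → HasDerivAt U (τ t - 1) t := by
  have hle : a ≤ a + 1 := by linarith
  have hi : IntervalIntegrable (fun t => τ t - 1) volume a (a + 1) := hτ.sub (by simp)
  have hU : ∀ s ∈ Icc a (a + 1), (∫ t in a..s, (τ t - 1)) = T s - s := by
    intro s hs
    have hsub : IntervalIntegrable τ volume a s := hτ.mono_set (by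
      rw [uIcc_of_le hs.1, uIcc_of_le hle]; exact Icc_subset_Icc_right hs.2)
    rw [intervalIntegral.integral_sub hsub (by simp), hT s hs]
    simp
    ring
  refine ⟨fun s => ∫ t in a..s, (τ t - 1),
    hi.absolutelyContinuousOnInterval_intervalIntegral left_mem_uIcc, by simp, ?_, hU, ?_⟩
  · simp only [hU (a + 1) (right_mem_Icc.2 hle), hTb, sub_self]
  · filter_upwards [hi.ae_hasDerivAt_integral] with t ht hmem
    rw [uIcc_of_le hle] at ht
    exact ht hmem a (left_mem_Icc.2 hle)

/-- Integration by parts: the weighted divergence of the displacement has zero integral. -/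
lemma integral_deriv_mul_displacement {K : NNReal} (hp : LipschitzWith K p)
    (hτ : IntervalIntegrable τ volume a (a + 1))
    (hT : ∀ s ∈ Icc a (a + 1), T s = a + ∫ t in a..s, τ t) (hTb : T (a + 1) = a + 1) :
    ∫ t in a..(a + 1), (deriv p t * (T t - t) + p t * (τ t - 1)) = 0 := by
  have hle : a ≤ a + 1 := by linarith
  obtain ⟨U, hUac, hUa, hUb, hUT, hUd⟩ := exists_displacement hτ hT hTb
  have hpac : AbsolutelyContinuousOnInterval p a (a + 1) :=
    hp.lipschitzOnWith.absolutelyContinuousOnInterval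
  have h := hpac.integral_deriv_mul_eq_sub hUac
  rw [hUa, hUb, mul_zero, mul_zero, sub_zero] at h
  rw [← h]
  apply intervalIntegral.integral_congr_ae
  filter_upwards [hUd] with t ht hmem
  rw [uIoc_of_le hle] at hmem
  have hmem' := Ioc_subset_Icc_self hmem
  rw [hUT t hmem', (ht hmem').deriv]

/-- The one-dimensional transportation cost inequality: for a weight that is convex up to a factor
`R`, the weighted quadratic cost of a map with derivative `τ` is controlled by
`∫ p (τ - 1 - log τ)`. -/
lemma lintegral_displacement_sq_le {R : ℝ} (hR : 1 ≤ R) (hp : Continuous p)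
    (hpos : ∀ t ∈ Ioo a (a + 1), 0 ≤ p t)
    (hconv : ∀ s ∈ Ioo a (a + 1), ∀ t ∈ Ioo a (a + 1), ∀ l : ℝ, 0 < l → l < 1 →
      p (l * s + (1 - l) * t) ≤ R * (l * p s + (1 - l) * p t))
    (hτ : IntervalIntegrable τ volume a (a + 1))
    (hτpos : ∀ᵐ t ∂volume.restrict (Ioo a (a + 1)), 0 < τ t)
    (hT : ∀ s ∈ Icc a (a + 1), T s = a + ∫ t in a..s, τ t) (hTb : T (a + 1) = a + 1)
    (hTmem : ∀ s ∈ Icc a (a + 1), T s ∈ Icc a (a + 1)) :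
    ∫⁻ t in Ioo a (a + 1), ENNReal.ofReal ((T t - t) ^ 2 * p t) ≤
      ENNReal.ofReal (4 * R ^ 2) *
        ∫⁻ t in Ioo a (a + 1), ENNReal.ofReal (p t * (τ t - 1 - Real.log (τ t))) := by
  have hle : a ≤ a + 1 := by linarith
  have hR0 : 0 < R := by linarith
  obtain ⟨U, hUac, hUa, hUb, hUT, hUd⟩ := exists_displacement hτ hT hTb
  have hUd' : ∀ᵐ t ∂volume.restrict (Ioo a (a + 1)), deriv U t = τ t - 1 := by
    rw [ae_restrict_iff' measurableSet_Ioo]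
    filter_upwards [hUd] with t ht hmem using (ht (Ioo_subset_Icc_self hmem)).deriv
  have hmemIoo : ∀ᵐ t ∂volume.restrict (Ioo a (a + 1)), t ∈ Ioo a (a + 1) :=
    ae_restrict_mem measurableSet_Ioo
  have hUbd : ∀ t ∈ Icc a (a + 1), |U t| ≤ 1 := by
    intro t ht
    rw [hUT t ht, abs_le]
    have := hTmem t ht
    constructor <;> linarith [ht.1, ht.2, this.1, this.2]
  have hUc : ContinuousOn U (uIcc a (a + 1)) := hUac.continuousOn
  have hUi : IntervalIntegrable (deriv U) volume a (a + 1) := hUac.intervalIntegrable_deriv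
  have hw : AbsolutelyContinuousOnInterval (fun t => U t * U t) a (a + 1) := hUac.mul hUac
  have hch := integral_mul_le_integral_mul_abs_deriv hR0.le hp hpos hconv hw
    (by simp [hUa]) (by simp [hUb])
  have hwd : ∀ᵐ t ∂volume.restrict (Ioo a (a + 1)),
      deriv (fun t => U t * U t) t = 2 * (U t * deriv U t) := by
    rw [ae_restrict_iff' measurableSet_Ioo]
    filter_upwards [hUd] with t ht hmem
    have := ht (Ioo_subset_Icc_self hmem)
    rw [(this.fun_mul this).deriv, this.deriv]
    ring
  have e2 : ∫ t in a..(a + 1), p t * |deriv (fun t => U t * U t) t| =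
      2 * ∫ t in a..(a + 1), p t * (|U t| * |deriv U t|) := by
    rw [← intervalIntegral.integral_const_mul, intervalIntegral.integral_of_le hle,
      intervalIntegral.integral_of_le hle, ← restrict_Ioo_eq_restrict_Ioc]
    apply integral_congr_ae
    filter_upwards [hwd] with t ht
    rw [ht, abs_mul, abs_mul, abs_two]
    ring
  rw [e2, intervalIntegral.integral_of_le hle, intervalIntegral.integral_of_le hle,
    ← restrict_Ioo_eq_restrict_Ioc] at hch
  have hch' : ∫ t in Ioo a (a + 1), p t * (U t * U t) ≤
      R * ∫ t in Ioo a (a + 1), p t * (|U t| * |deriv U t|) := by linarith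
  have hI1 : IntegrableOn (fun t => p t * (U t * U t)) (Ioo a (a + 1)) := by
    have : ContinuousOn (fun t => p t * (U t * U t)) (Icc a (a + 1)) := by
      rw [uIcc_of_le hle] at hUc
      exact hp.continuousOn.mul (hUc.mul hUc)
    exact (this.integrableOn_Icc).mono_set Ioo_subset_Icc_self
  have hI2 : IntegrableOn (fun t => p t * (|U t| * |deriv U t|)) (Ioo a (a + 1)) := by
    have := (hUi.abs.continuousOn_mul hUc.abs).continuousOn_mul hp.continuousOn
    rw [intervalIntegrable_iff_integrableOn_Ioo_of_le hle] at this
    exact this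
  have hm1 : AEMeasurable (fun t => ENNReal.ofReal (p t * (U t * U t)))
      (volume.restrict (Ioo a (a + 1))) := hI1.aemeasurable.ennreal_ofReal
  -- the same inequality between extended non-negative integrals
  have hE : ∫⁻ t in Ioo a (a + 1), ENNReal.ofReal (p t * (U t * U t)) ≤
      ∫⁻ t in Ioo a (a + 1), ENNReal.ofReal (R * (p t * (|U t| * |deriv U t|))) := by
    rw [← ofReal_integral_eq_lintegral_ofReal hI1, ← ofReal_integral_eq_lintegral_ofReal
      (hI2.const_mul R), integral_const_mul]
    · exact ENNReal.ofReal_le_ofReal hch'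
    · filter_upwards [hmemIoo] with t ht
      have := hpos t ht
      simp only [Pi.zero_apply]
      positivity
    · filter_upwards [hmemIoo] with t ht
      have := hpos t ht
      exact mul_nonneg this (mul_self_nonneg _)
  have hY : ∫⁻ t in Ioo a (a + 1), ENNReal.ofReal (R * (p t * (|U t| * |deriv U t|))) ≤
      ∫⁻ t in Ioo a (a + 1), (ENNReal.ofReal (2 * R ^ 2) *
        ENNReal.ofReal (p t * (τ t - 1 - Real.log (τ t))) +
        ENNReal.ofReal (1 / 2) * ENNReal.ofReal (p t * (U t * U t))) := by
    apply lintegral_mono_ae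
    filter_upwards [hmemIoo, hUd', hτpos] with t ht hd hpt
    have hp0 := hpos t ht
    have hφ : 0 ≤ τ t - 1 - Real.log (τ t) := by linarith [Real.log_le_sub_one_of_pos hpt]
    rw [← ENNReal.ofReal_mul (by positivity), ← ENNReal.ofReal_mul (by norm_num),
      ← ENNReal.ofReal_add (by positivity) (mul_nonneg (by norm_num)
        (mul_nonneg hp0 (mul_self_nonneg _)))]
    apply ENNReal.ofReal_le_ofReal
    rw [hd]
    have := mul_le_mul_of_nonneg_left
      (mul_abs_mul_abs_le hR (hUbd t (Ioo_subset_Icc_self ht)) hpt) hp0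
    linarith
  rw [lintegral_add_right' _ (hm1.const_mul _), lintegral_const_mul' _ _ ENNReal.ofReal_ne_top,
    lintegral_const_mul' _ _ ENNReal.ofReal_ne_top] at hY
  have hfin : ∫⁻ t in Ioo a (a + 1), ENNReal.ofReal (p t * (U t * U t)) ≠ ⊤ :=
    hI1.lintegral_lt_top.ne
  have e3 : ∫⁻ t in Ioo a (a + 1), ENNReal.ofReal ((T t - t) ^ 2 * p t) =
      ∫⁻ t in Ioo a (a + 1), ENNReal.ofReal (p t * (U t * U t)) := by
    refine setLIntegral_congr_fun measurableSet_Ioo fun t ht => ?_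
    rw [hUT t (Ioo_subset_Icc_self ht)]
    ring_nf
  rw [e3]
  have hfinal := hE.trans hY
  generalize ∫⁻ t in Ioo a (a + 1), ENNReal.ofReal (p t * (U t * U t)) = A at hfin hfinal ⊢
  generalize ∫⁻ t in Ioo a (a + 1), ENNReal.ofReal (p t * (τ t - 1 - Real.log (τ t))) = B
    at hfinal ⊢
  -- absorb half of the left-hand side
  have h2 : (2 : ENNReal) * ENNReal.ofReal (1 / 2) = 1 := by
    rw [← ENNReal.ofReal_ofNat, ← ENNReal.ofReal_mul (by norm_num)]; norm_num
  have h3 : A + A ≤ ENNReal.ofReal (4 * R ^ 2) * B + A := by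
    calc A + A = 2 * A := (two_mul A).symm
      _ ≤ 2 * (ENNReal.ofReal (2 * R ^ 2) * B + ENNReal.ofReal (1 / 2) * A) := by gcongr
      _ = (2 * ENNReal.ofReal (2 * R ^ 2)) * B + (2 * ENNReal.ofReal (1 / 2)) * A := by ring
      _ = _ := by
        rw [h2, one_mul, ← ENNReal.ofReal_ofNat, ← ENNReal.ofReal_mul (by norm_num)]
        ring_nf
  exact (ENNReal.add_le_add_iff_right hfin).1 h3

end Displacement

/-! ### Monotone transport between measures on a unit interval -/

/-- Lebesgue measure on the open interval `(a, a + 1)`. -/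
noncomputable def unitVolume (a : ℝ) : Measure ℝ := volume.restrict (Ioo a (a + 1))

instance (a : ℝ) : IsProbabilityMeasure (unitVolume a) :=
  ⟨by simp [unitVolume]⟩

instance (a : ℝ) : NullSingletonClass (unitVolume a) := by unfold unitVolume; infer_instance

/-- `ν` is a probability measure without atoms on `(a, a + 1)`, of full support there. -/
structure IsFullOn (a : ℝ) (ν : Measure ℝ) : Prop where
  prob : IsProbabilityMeasure ν
  noAtoms : NullSingletonClass ν
  ae_mem : ∀ᵐ x ∂ν, x ∈ Ioo a (a + 1)
  pos : ∀ s t, a ≤ s → s < t → t ≤ a + 1 → 0 < ν (Ioc s t)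

lemma isFullOn_withDensity {a : ℝ} {q : ℝ → ENNReal} (hq : Measurable q) (hq0 : ∀ t, q t ≠ 0)
    (hq1 : ∫⁻ t, q t ∂unitVolume a = 1) : IsFullOn a ((unitVolume a).withDensity q) where
  prob := ⟨by rw [withDensity_apply _ .univ, setLIntegral_univ, hq1]⟩
  noAtoms := ⟨fun x => (withDensity_absolutelyContinuous _ _) (measure_singleton x)⟩
  ae_mem := (withDensity_absolutelyContinuous _ _).ae_le (ae_restrict_mem measurableSet_Ioo)
  pos s t hs hst ht := by
    rw [pos_iff_ne_zero]
    intro h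
    have h2 : unitVolume a (Ioc s t) = 0 :=
      (withDensity_absolutelyContinuous' hq.aemeasurable (ae_of_all _ hq0)) h
    have h3 : Ioo s t ⊆ Ioc s t ∩ Ioo a (a + 1) := fun x hx =>
      ⟨⟨hx.1, hx.2.le⟩, hs.trans_lt hx.1, hx.2.trans_le ht⟩
    rw [unitVolume, Measure.restrict_apply measurableSet_Ioc] at h2
    have h4 := measure_mono_null h3 h2
    rw [Real.volume_Ioo, ENNReal.ofReal_eq_zero] at h4
    linarith

lemma continuous_measureReal_Iic (ν : Measure ℝ) [IsFiniteMeasure ν] [NullSingletonClass ν] :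
    Continuous fun x => ν.real (Iic x) := by
  have h : ∀ x, ν.real (Iic x) = ν.real (Iic 0) + ∫ _ in (0 : ℝ)..x, (1 : ℝ) ∂ν := by
    intro x
    have := intervalIntegral.integral_Iic_sub_Iic (μ := ν) (f := fun _ => (1 : ℝ)) (a := 0) (b := x)
      (integrable_const _) (integrable_const _)
    rw [← this]
    simp
  rw [funext h]
  refine continuous_const.add (intervalIntegral.continuous_primitive (fun a b => ?_) 0)
  exact (integrable_const _).intervalIntegrable

lemma IsFullOn.strictMonoOn {a : ℝ} {ν : Measure ℝ} (h : IsFullOn a ν) :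
    StrictMonoOn (fun x => ν.real (Iic x)) (Icc a (a + 1)) := by
  intro s hs t ht hst
  have := h.prob
  have h1 : ν.real (Iic s ∪ Ioc s t) = ν.real (Iic s) + ν.real (Ioc s t) :=
    measureReal_union (Set.disjoint_left.2 fun x hx hx' => not_lt.2 hx hx'.1) measurableSet_Ioc
  rw [Iic_union_Ioc_eq_Iic hst.le] at h1
  have h2 : 0 < ν.real (Ioc s t) :=
    ENNReal.toReal_pos (h.pos s t hs.1 hst ht.2).ne' (measure_ne_top _ _)
  simp only [h1]
  linarith

lemma IsFullOn.measure_Iic_of_le {a x : ℝ} {ν : Measure ℝ} (h : IsFullOn a ν) (hx : x ≤ a) :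
    ν (Iic x) = 0 := by
  refine measure_mono_null ?_ (ae_iff.1 h.ae_mem)
  intro y hy hy'
  exact absurd hy'.1 (not_lt.2 ((mem_Iic.1 hy).trans hx))

lemma IsFullOn.measure_Iic_of_ge {a x : ℝ} {ν : Measure ℝ} (h : IsFullOn a ν) (hx : a + 1 ≤ x) :
    ν (Iic x) = 1 := by
  have := h.prob
  rw [← prob_compl_eq_zero_iff measurableSet_Iic]
  refine measure_mono_null ?_ (ae_iff.1 h.ae_mem)
  intro y hy hy'
  exact hy (hy'.2.le.trans hx)

/-- The quantile function of `ν`, as a map to `[a, a + 1]`. -/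
noncomputable def quantile (a : ℝ) (ν : Measure ℝ) (r : ℝ) : ℝ :=
  sInf {s ∈ Icc a (a + 1) | r ≤ ν.real (Iic s)}

lemma IsFullOn.quantile_spec {a : ℝ} {ν : Measure ℝ} (h : IsFullOn a ν) {r : ℝ} (h0 : 0 ≤ r)
    (h1 : r ≤ 1) : quantile a ν r ∈ Icc a (a + 1) ∧ ν.real (Iic (quantile a ν r)) = r := by
  have := h.prob
  have := h.noAtoms
  have hle : a ≤ a + 1 := by linarith
  obtain ⟨s, hs, hsr⟩ : r ∈ (fun x => ν.real (Iic x)) '' Icc a (a + 1) := by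
    apply intermediate_value_Icc hle (continuous_measureReal_Iic ν).continuousOn
    simp only [measureReal_def, h.measure_Iic_of_le le_rfl, h.measure_Iic_of_ge le_rfl]
    exact ⟨h0, h1⟩
  have hl : IsLeast {s ∈ Icc a (a + 1) | r ≤ ν.real (Iic s)} s := by
    refine ⟨⟨hs, hsr.ge⟩, fun t ht => ?_⟩
    rw [← hsr] at ht
    exact (h.strictMonoOn.le_iff_le hs ht.1).1 ht.2
  rw [quantile, hl.csInf_eq]
  exact ⟨hs, hsr⟩

lemma IsFullOn.quantile_le_iff {a : ℝ} {ν : Measure ℝ} (h : IsFullOn a ν) {r s : ℝ} (h0 : 0 ≤ r)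
    (h1 : r ≤ 1) (hs : s ∈ Icc a (a + 1)) : quantile a ν r ≤ s ↔ r ≤ ν.real (Iic s) := by
  obtain ⟨hm, he⟩ := h.quantile_spec h0 h1
  rw [← h.strictMonoOn.le_iff_le hm hs]
  simp only [he]

section Transport

variable {a : ℝ} {ν₁ ν₂ : Measure ℝ}

/-- The increasing map that transports `ν₁` to `ν₂`. -/
noncomputable def monoTransport (a : ℝ) (ν₁ ν₂ : Measure ℝ) (x : ℝ) : ℝ :=
  quantile a ν₂ (ν₁.real (Iic x))

lemma monoTransport_mem (h₁ : IsFullOn a ν₁) (h₂ : IsFullOn a ν₂) (x : ℝ) :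
    monoTransport a ν₁ ν₂ x ∈ Icc a (a + 1) :=
  have := h₁.prob
  (h₂.quantile_spec measureReal_nonneg measureReal_le_one).1

lemma measureReal_Iic_monoTransport (h₁ : IsFullOn a ν₁) (h₂ : IsFullOn a ν₂) (x : ℝ) :
    ν₂.real (Iic (monoTransport a ν₁ ν₂ x)) = ν₁.real (Iic x) :=
  have := h₁.prob
  (h₂.quantile_spec measureReal_nonneg measureReal_le_one).2

lemma monoTransport_le_iff (h₁ : IsFullOn a ν₁) (h₂ : IsFullOn a ν₂) {x s : ℝ}
    (hs : s ∈ Icc a (a + 1)) :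
    monoTransport a ν₁ ν₂ x ≤ s ↔ ν₁.real (Iic x) ≤ ν₂.real (Iic s) :=
  have := h₁.prob
  h₂.quantile_le_iff measureReal_nonneg measureReal_le_one hs

lemma strictMonoOn_monoTransport (h₁ : IsFullOn a ν₁) (h₂ : IsFullOn a ν₂) :
    StrictMonoOn (monoTransport a ν₁ ν₂) (Icc a (a + 1)) := by
  intro x hx y hy hxy
  by_contra hlt
  rw [not_lt, monoTransport_le_iff h₁ h₂ (monoTransport_mem h₁ h₂ x),
    measureReal_Iic_monoTransport h₁ h₂] at hlt
  exact absurd (h₁.strictMonoOn hx hy hxy) (not_lt.2 hlt)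

lemma monotone_monoTransport (h₁ : IsFullOn a ν₁) (h₂ : IsFullOn a ν₂) :
    Monotone (monoTransport a ν₁ ν₂) := by
  intro x y hxy
  have := h₁.prob
  rw [monoTransport_le_iff h₁ h₂ (monoTransport_mem h₁ h₂ y), measureReal_Iic_monoTransport h₁ h₂]
  exact measureReal_mono (Iic_subset_Iic.2 hxy)

lemma map_monoTransport (h₁ : IsFullOn a ν₁) (h₂ : IsFullOn a ν₂) :
    ν₁.map (monoTransport a ν₁ ν₂) = ν₂ := by
  have := h₁.prob
  have := h₂.prob
  have hm := (monotone_monoTransport h₁ h₂).measurable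
  have : IsProbabilityMeasure (ν₁.map (monoTransport a ν₁ ν₂)) :=
    Measure.isProbabilityMeasure_map hm.aemeasurable
  apply Measure.ext_of_Iic
  intro s
  rw [Measure.map_apply hm measurableSet_Iic]
  rcases lt_or_ge s a with hs | hs
  · rw [h₂.measure_Iic_of_le hs.le]
    convert measure_empty (μ := ν₁)
    ext x
    simpa using hs.trans_le (monoTransport_mem h₁ h₂ x).1
  rcases le_or_gt (a + 1) s with hs' | hs'
  · rw [h₂.measure_Iic_of_ge hs']
    convert measure_univ (μ := ν₁)
    ext x
    simpa using (monoTransport_mem h₁ h₂ x).2.trans hs'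
  · have hsI : s ∈ Icc a (a + 1) := ⟨hs, hs'.le⟩
    -- the preimage of `(-∞, s]` is `(-∞, x]` for the image `x` of `s` under the reverse transport
    have hxI := monoTransport_mem h₂ h₁ s
    have hx := measureReal_Iic_monoTransport h₂ h₁ s
    have hae : monoTransport a ν₁ ν₂ ⁻¹' Iic s =ᵐ[ν₁] Iic (monoTransport a ν₂ ν₁ s) := by
      filter_upwards [h₁.ae_mem] with y hy
      apply propext
      change monoTransport a ν₁ ν₂ y ≤ s ↔ y ≤ _
      rw [monoTransport_le_iff h₁ h₂ hsI, ← hx]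
      exact h₁.strictMonoOn.le_iff_le (Ioo_subset_Icc_self hy) hxI
    rw [measure_congr hae, ← ENNReal.toReal_eq_toReal_iff' (measure_ne_top _ _)
      (measure_ne_top _ _)]
    exact hx

end Transport

section Density

variable {a : ℝ} {p q : ℝ → ENNReal}

lemma lintegral_monoTransport (hp : Measurable p) (hq : Measurable q) (hp0 : ∀ t, p t ≠ 0)
    (hq0 : ∀ t, q t ≠ 0) (hp1 : ∫⁻ t, p t ∂unitVolume a = 1)
    (hq1 : ∫⁻ t, q t ∂unitVolume a = 1) {h : ℝ → ENNReal} (hh : Measurable h) :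
    ∫⁻ t, p t * h (monoTransport a ((unitVolume a).withDensity p) ((unitVolume a).withDensity q) t)
      ∂unitVolume a = ∫⁻ s, q s * h s ∂unitVolume a := by
  have h₁ := isFullOn_withDensity hp hp0 hp1
  have h₂ := isFullOn_withDensity hq hq0 hq1
  have hT := (monotone_monoTransport h₁ h₂).measurable
  have e1 := lintegral_withDensity_eq_lintegral_mul (unitVolume a) hp (hh.comp hT)
  have e2 := lintegral_withDensity_eq_lintegral_mul (unitVolume a) hq hh
  simp only [Pi.mul_apply, Function.comp_apply] at e1 e2
  rw [← e1, ← e2, ← lintegral_map hh hT, map_monoTransport h₁ h₂]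

/-- The monotone transport `T` from the density `p` to the density `q` is absolutely continuous
with derivative `p / q ∘ T`: push forward the function `1 / q` on `(-∞, T s]`. -/
lemma lintegral_div_monoTransport (hp : Measurable p) (hq : Measurable q) (hp0 : ∀ t, p t ≠ 0)
    (hq0 : ∀ t, q t ≠ 0) (hp1 : ∫⁻ t, p t ∂unitVolume a = 1)
    (hq1 : ∫⁻ t, q t ∂unitVolume a = 1) {T : ℝ → ℝ}
    (hT : T = monoTransport a ((unitVolume a).withDensity p) ((unitVolume a).withDensity q))
    {s : ℝ} (hs : s ∈ Icc a (a + 1)) :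
    ∫⁻ t in Iic s, p t / q (T t) ∂unitVolume a = ENNReal.ofReal (T s - a) := by
  have h₁ := isFullOn_withDensity hp hp0 hp1
  have h₂ := isFullOn_withDensity hq hq0 hq1
  have hTs : T s ∈ Icc a (a + 1) := hT ▸ monoTransport_mem h₁ h₂ s
  have hmono : StrictMonoOn T (Icc a (a + 1)) := hT ▸ strictMonoOn_monoTransport h₁ h₂
  have hmem : ∀ᵐ t ∂unitVolume a, t ∈ Ioo a (a + 1) := ae_restrict_mem measurableSet_Ioo
  have hqfin : ∀ᵐ t ∂unitVolume a, q t < ⊤ := ae_lt_top hq (by rw [hq1]; simp)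
  have h := lintegral_monoTransport hp hq hp0 hq0 hp1 hq1
    (h := (Iic (T s)).indicator fun y => (q y)⁻¹) (hq.inv.indicator measurableSet_Iic)
  rw [← hT] at h
  calc ∫⁻ t in Iic s, p t / q (T t) ∂unitVolume a
      = ∫⁻ t, p t * (Iic (T s)).indicator (fun y => (q y)⁻¹) (T t) ∂unitVolume a := by
        rw [← lintegral_indicator measurableSet_Iic]
        apply lintegral_congr_ae
        filter_upwards [hmem] with t ht
        have hiff : t ∈ Iic s ↔ T t ∈ Iic (T s) :=
          (hmono.le_iff_le (Ioo_subset_Icc_self ht) hs).symm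
        by_cases hc : t ∈ Iic s
        · rw [indicator_of_mem hc, indicator_of_mem (hiff.1 hc), ENNReal.div_eq_inv_mul, mul_comm]
        · rw [indicator_of_notMem hc, indicator_of_notMem (fun hc' => hc (hiff.2 hc')), mul_zero]
    _ = ∫⁻ y, q y * (Iic (T s)).indicator (fun y => (q y)⁻¹) y ∂unitVolume a := h
    _ = ∫⁻ y, (Iic (T s)).indicator 1 y ∂unitVolume a := by
        apply lintegral_congr_ae
        filter_upwards [hqfin] with y hy
        by_cases hc : y ∈ Iic (T s)
        · simp [indicator_of_mem hc, ENNReal.mul_inv_cancel (hq0 y) hy.ne]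
        · simp [indicator_of_notMem hc]
    _ = unitVolume a (Iic (T s)) := lintegral_indicator_one measurableSet_Iic
    _ = volume (Iic (T s) ∩ Ioo a (a + 1)) := Measure.restrict_apply measurableSet_Iic
    _ = volume (Ioc a (T s)) := by
        apply measure_congr
        filter_upwards [(measure_eq_zero_iff_ae_notMem.1 (Real.volume_singleton (a := a + 1)))]
          with y hy
        apply propext
        change (y ≤ T s ∧ a < y ∧ y < a + 1) ↔ (a < y ∧ y ≤ T s)
        refine ⟨fun h => ⟨h.2.1, h.1⟩, fun h => ⟨h.2, h.1, lt_of_le_of_ne (h.2.trans hTs.2) hy⟩⟩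
    _ = ENNReal.ofReal (T s - a) := Real.volume_Ioc

/-- Real-valued form of `lintegral_div_monoTransport`. -/
lemma monoTransport_eq_integral (hp : Measurable p) (hq : Measurable q) (hp0 : ∀ t, p t ≠ 0)
    (hq0 : ∀ t, q t ≠ 0) (hp1 : ∫⁻ t, p t ∂unitVolume a = 1)
    (hq1 : ∫⁻ t, q t ∂unitVolume a = 1) {T : ℝ → ℝ}
    (hT : T = monoTransport a ((unitVolume a).withDensity p) ((unitVolume a).withDensity q)) :
    T (a + 1) = a + 1 ∧
    IntervalIntegrable (fun t => (p t / q (T t)).toReal) volume a (a + 1) ∧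
    ∀ s ∈ Icc a (a + 1), T s = a + ∫ t in a..s, (p t / q (T t)).toReal := by
  have hle : a ≤ a + 1 := by linarith
  have h₁ := isFullOn_withDensity hp hp0 hp1
  have h₂ := isFullOn_withDensity hq hq0 hq1
  have hTm : Measurable T := hT ▸ (monotone_monoTransport h₁ h₂).measurable
  have hmem : ∀ s, T s ∈ Icc a (a + 1) := fun s => hT ▸ monoTransport_mem h₁ h₂ s
  have hm : Measurable fun t => p t / q (T t) := hp.div (hq.comp hTm)
  have hres : ∀ s ∈ Icc a (a + 1), (unitVolume a).restrict (Iic s) = volume.restrict (Ioc a s) := by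
    intro s hs
    rw [unitVolume, restrict_Ioo_eq_restrict_Ioc, Measure.restrict_restrict measurableSet_Iic]
    congr 1
    ext y
    simp only [mem_inter_iff, mem_Iic, mem_Ioc]
    exact ⟨fun h => ⟨h.2.1, h.1⟩, fun h => ⟨h.2, h.1, h.2.trans hs.2⟩⟩
  have key : ∀ s ∈ Icc a (a + 1), ∫⁻ t in Ioc a s, p t / q (T t) = ENNReal.ofReal (T s - a) := by
    intro s hs
    rw [← hres s hs]
    exact lintegral_div_monoTransport hp hq hp0 hq0 hp1 hq1 hT hs
  have hne : ∀ s ∈ Icc a (a + 1), ∫⁻ t in Ioc a s, p t / q (T t) ≠ ⊤ := fun s hs => by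
    rw [key s hs]; exact ENNReal.ofReal_ne_top
  refine ⟨?_, ?_, fun s hs => ?_⟩
  · have e := measureReal_Iic_monoTransport h₁ h₂ (a + 1)
    rw [← hT] at e
    refine h₂.strictMonoOn.injOn (hmem _) (right_mem_Icc.2 hle) ?_
    simp only [e]
    simp only [measureReal_def, h₁.measure_Iic_of_ge le_rfl, h₂.measure_Iic_of_ge le_rfl]
  · rw [intervalIntegrable_iff_integrableOn_Ioc_of_le hle]
    exact integrable_toReal_of_lintegral_ne_top hm.aemeasurable (hne _ (right_mem_Icc.2 hle))
  · rw [intervalIntegral.integral_of_le hs.1, integral_toReal hm.aemeasurable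
      (ae_lt_top hm (hne s hs)), key s hs, ENNReal.toReal_ofReal (by linarith [(hmem s).1])]
    ring

end Density

/-! ### Marginals and conditional densities on a unit cube -/

/-- The coordinates with index at least `k`. -/
def coordsFrom (n k : ℕ) : Finset (Fin n) := Finset.univ.filter fun i => k ≤ i.val

lemma mem_coordsFrom {n k : ℕ} {i : Fin n} : i ∈ coordsFrom n k ↔ k ≤ i.val := by
  simp [coordsFrom]

lemma coordsFrom_eq_insert {n : ℕ} (i : Fin n) :
    coordsFrom n i = insert i (coordsFrom n (i + 1)) := by
  ext j
  simp only [mem_coordsFrom, Finset.mem_insert, Fin.ext_iff]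
  omega

/-- `h` depends only on the coordinates with index less than `k`. -/
def DependsBelow {n : ℕ} {β : Type*} (k : ℕ) (h : (Fin n → ℝ) → β) : Prop :=
  ∀ x y : Fin n → ℝ, (∀ j, j.val < k → x j = y j) → h x = h y

section Marginals

variable {n : ℕ} (a : Fin n → ℝ)

/-- Lebesgue measure on the open unit cube with lower corner `a`. -/
noncomputable def cubeVolume : Measure (Fin n → ℝ) := Measure.pi fun i => unitVolume (a i)

instance : IsProbabilityMeasure (cubeVolume a) := by unfold cubeVolume; infer_instance

/-- The marginal of `h` in the coordinates with index less than `k`: the integral of `h` over the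
other ones, as a function on the whole space. -/
noncomputable def marg (h : (Fin n → ℝ) → ENNReal) (k : ℕ) : (Fin n → ℝ) → ENNReal :=
  lmarginal (fun i => unitVolume (a i)) (coordsFrom n k) h

/-- The density of coordinate `i` given the previous coordinates of `x`. -/
noncomputable def condDensity (h : (Fin n → ℝ) → ENNReal) (i : Fin n) (x : Fin n → ℝ) (t : ℝ) :
    ENNReal :=
  marg a h (i + 1) (Function.update x i t) / marg a h i x

/-- The law of coordinate `i` given the previous coordinates of `x`. -/
noncomputable def condLaw (h : (Fin n → ℝ) → ENNReal) (i : Fin n) (x : Fin n → ℝ) : Measure ℝ :=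
  (unitVolume (a i)).withDensity (condDensity a h i x)

variable {a} {h : (Fin n → ℝ) → ENNReal}

lemma measurable_marg (hh : Measurable h) (k : ℕ) : Measurable (marg a h k) := hh.lmarginal _

lemma lintegral_density_ne_zero (hh : Measurable h) (h0 : ∀ x, h x ≠ 0) :
    ∫⁻ x, h x ∂cubeVolume a ≠ 0 := by
  intro hc
  obtain ⟨y, hy⟩ := ((lintegral_eq_zero_iff hh).1 hc).exists
  exact h0 _ hy

/-- A map that satisfies the transport identity for the indicator of a null set avoids that null
set almost surely. -/
lemma ae_notMem_of_transport {f g : (Fin n → ℝ) → ENNReal} {T : (Fin n → ℝ) → (Fin n → ℝ)}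
    (hf : Measurable f) (hf0 : ∀ x, f x ≠ 0) (hg : Measurable g) (hg0 : ∀ x, g x ≠ 0)
    (hT : Measurable T) {s : Set (Fin n → ℝ)} (hs : MeasurableSet s)
    (hs0 : ∀ᵐ y ∂cubeVolume a, y ∉ s)
    (h : (∫⁻ x, s.indicator 1 (T x) * f x ∂cubeVolume a) * ∫⁻ x, g x ∂cubeVolume a =
      (∫⁻ y, s.indicator 1 y * g y ∂cubeVolume a) * ∫⁻ x, f x ∂cubeVolume a) :
    ∀ᵐ x ∂cubeVolume a, T x ∉ s := by
  have h1 : Measurable (s.indicator (1 : (Fin n → ℝ) → ENNReal)) := measurable_one.indicator hs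
  have h0 : ∫⁻ y, s.indicator 1 y * g y ∂cubeVolume a = 0 := by
    refine (lintegral_eq_zero_iff (h1.mul hg)).2 ?_
    filter_upwards [hs0] with y hy
    simp [hy]
  rw [h0, zero_mul, mul_eq_zero, or_iff_left (lintegral_density_ne_zero hg hg0)] at h
  filter_upwards [(lintegral_eq_zero_iff ((h1.comp hT).mul hf)).1 h] with x hx hc
  simp [hc, hf0 x] at hx

lemma dependsBelow_marg (k : ℕ) : DependsBelow k (marg a h k) := fun x y hxy =>
  lmarginal_congr _ _ fun i hi => hxy i (by simpa [mem_coordsFrom] using hi)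

lemma marg_eq_lintegral (hh : Measurable h) (i : Fin n) (x : Fin n → ℝ) :
    marg a h i x = ∫⁻ t, marg a h (i + 1) (Function.update x i t) ∂unitVolume (a i) := by
  rw [marg, coordsFrom_eq_insert, lmarginal_insert _ hh (by simp [mem_coordsFrom])]
  rfl

lemma marg_zero (x : Fin n → ℝ) : marg a h 0 x = ∫⁻ y, h y ∂cubeVolume a := by
  have : coordsFrom n 0 = Finset.univ := by ext; simp [mem_coordsFrom]
  rw [marg, this, lmarginal_univ]
  rfl

lemma marg_self : marg a h n = h := by
  have : coordsFrom n n = ∅ := by ext i; simp [mem_coordsFrom]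
  rw [marg, this, lmarginal_empty]

lemma marg_ne_zero (hh : Measurable h) (h0 : ∀ x, h x ≠ 0) (k : ℕ) (x : Fin n → ℝ) :
    marg a h k x ≠ 0 := by
  intro hc
  rw [marg, lmarginal] at hc
  replace hc := (lintegral_eq_zero_iff (hh.comp measurable_updateFinset)).1 hc
  obtain ⟨y, hy⟩ := hc.exists
  exact h0 _ hy

lemma marg_ne_top {M : ENNReal} (hM : M ≠ ⊤) (hle : ∀ x, h x ≤ M) (k : ℕ) (x : Fin n → ℝ) :
    marg a h k x ≠ ⊤ := by
  refine ne_top_of_le_ne_top hM ?_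
  rw [marg, lmarginal]
  exact (lintegral_mono fun y => hle _).trans (by simp)

/-- Against a function of the coordinates with index less than `k`, a density may be replaced by
its marginal in these coordinates. -/
lemma lintegral_mul_marg (hh : Measurable h) {H : (Fin n → ℝ) → ENNReal} (hH : Measurable H)
    {k : ℕ} (hd : DependsBelow k H) :
    ∫⁻ x, H x * h x ∂cubeVolume a = ∫⁻ x, H x * marg a h k x ∂cubeVolume a := by
  refine lintegral_eq_of_lmarginal_eq (coordsFrom n k) (hH.mul hh)
    (hH.mul (measurable_marg hh k)) ?_
  ext x
  have hu : ∀ y : (i : coordsFrom n k) → ℝ, ∀ j : Fin n, j.val < k →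
      Function.updateFinset x (coordsFrom n k) y j = x j := by
    intro y j hj
    have : j ∉ coordsFrom n k := by simp [mem_coordsFrom, hj]
    simp [Function.updateFinset, this]
  simp only [lmarginal]
  simp_rw [hd _ x (hu _), dependsBelow_marg k _ x (hu _)]
  refine (lintegral_const_mul _ (hh.comp measurable_updateFinset)).trans ?_
  simp [marg, lmarginal]

/-- Tonelli's theorem on a cube, with one coordinate resampled; there is no normalization because
every coordinate interval has unit length. -/
lemma lintegral_update {Φ : (Fin n → ℝ) → ENNReal} (hΦ : Measurable Φ) (i : Fin n) :
    ∫⁻ x, Φ x ∂cubeVolume a =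
      ∫⁻ x, ∫⁻ t, Φ (Function.update x i t) ∂unitVolume (a i) ∂cubeVolume a := by
  have hm : Measurable fun x => ∫⁻ t, Φ (Function.update x i t) ∂unitVolume (a i) :=
    (hΦ.comp measurable_update').lintegral_prod_right'
  refine lintegral_eq_of_lmarginal_eq {i} hΦ hm ?_
  rw [lmarginal_singleton, lmarginal_singleton]
  simp

/-- Almost every line parallel to a coordinate axis meets a null set in a null set. -/
lemma ae_update {P : (Fin n → ℝ) → Prop} (hP : ∀ᵐ x ∂cubeVolume a, P x) (i : Fin n) :
    ∀ᵐ x ∂cubeVolume a, ∀ᵐ t ∂unitVolume (a i), P (Function.update x i t) := by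
  obtain ⟨s, hs, hsm, hs0⟩ := exists_measurable_superset_of_null (ae_iff.1 hP)
  have h1 := lintegral_update (a := a) (Φ := s.indicator 1) (measurable_one.indicator hsm) i
  rw [lintegral_indicator_one hsm, hs0, eq_comm] at h1
  replace h1 := (lintegral_eq_zero_iff
    (((measurable_one.indicator hsm).comp measurable_update').lintegral_prod_right')).1 h1
  filter_upwards [h1] with x hx
  replace hx := (lintegral_eq_zero_iff
    ((measurable_one.indicator hsm).comp (measurable_update x))).1 hx
  filter_upwards [hx] with t ht
  by_contra hc
  have : Function.update x i t ∈ s := hs hc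
  simp [this] at ht

lemma ae_marg_lt_top (hh : Measurable h) (hfin : ∫⁻ x, h x ∂cubeVolume a ≠ ⊤) (k : ℕ) :
    ∀ᵐ x ∂cubeVolume a, marg a h k x < ⊤ := by
  apply ae_lt_top (measurable_marg hh k)
  have := lintegral_mul_marg (a := a) hh (H := fun _ => 1) measurable_const (k := k)
    (fun _ _ _ => rfl)
  simp only [one_mul] at this
  rwa [← this]

lemma condDensity_congr {i : Fin n} {x y : Fin n → ℝ} (hxy : ∀ j < i, x j = y j) :
    condDensity a h i x = condDensity a h i y := by
  ext t
  rw [condDensity, condDensity, dependsBelow_marg i x y fun j hj => hxy j hj]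
  congr 1
  apply dependsBelow_marg
  intro j hj
  rcases eq_or_ne j i with rfl | hne
  · simp
  · rw [Function.update_of_ne hne, Function.update_of_ne hne]
    exact hxy j (lt_of_le_of_ne (Nat.lt_succ_iff.1 hj) hne)

lemma condLaw_congr {i : Fin n} {x y : Fin n → ℝ} (hxy : ∀ j < i, x j = y j) :
    condLaw a h i x = condLaw a h i y := by
  rw [condLaw, condLaw, condDensity_congr hxy]

lemma condDensity_update {i : Fin n} {x : Fin n → ℝ} {t : ℝ} :
    condDensity a h i (Function.update x i t) = condDensity a h i x :=
  condDensity_congr fun _ hj => Function.update_of_ne hj.ne _ _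

lemma measurable_condDensity_uncurry (hh : Measurable h) (i : Fin n) :
    Measurable fun z : (Fin n → ℝ) × ℝ => condDensity a h i z.1 z.2 :=
  ((measurable_marg hh _).comp measurable_update').div
    ((measurable_marg hh _).comp measurable_fst)

lemma measurable_condDensity (hh : Measurable h) (i : Fin n) (x : Fin n → ℝ) :
    Measurable (condDensity a h i x) :=
  (measurable_condDensity_uncurry hh i).comp measurable_prodMk_left

lemma condDensity_ne_zero (hh : Measurable h) (h0 : ∀ x, h x ≠ 0) {i : Fin n} {x : Fin n → ℝ}
    (hx : marg a h i x ≠ ⊤) (t : ℝ) : condDensity a h i x t ≠ 0 :=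
  ENNReal.div_ne_zero.2 ⟨marg_ne_zero hh h0 _ _, hx⟩

lemma lintegral_condDensity (hh : Measurable h) (h0 : ∀ x, h x ≠ 0) {i : Fin n} {x : Fin n → ℝ}
    (hx : marg a h i x ≠ ⊤) : ∫⁻ t, condDensity a h i x t ∂unitVolume (a i) = 1 := by
  simp only [condDensity, div_eq_mul_inv]
  refine (lintegral_mul_const _ ((measurable_marg hh _).comp (measurable_update x))).trans ?_
  change (∫⁻ t, marg a h (i + 1) (Function.update x i t) ∂unitVolume (a i)) * _ = 1
  rw [← marg_eq_lintegral hh, ENNReal.mul_inv_cancel (marg_ne_zero hh h0 _ _) hx]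

lemma isFullOn_condLaw (hh : Measurable h) (h0 : ∀ x, h x ≠ 0) {i : Fin n} {x : Fin n → ℝ}
    (hx : marg a h i x ≠ ⊤) : IsFullOn (a i) (condLaw a h i x) :=
  isFullOn_withDensity (measurable_condDensity hh i x) (condDensity_ne_zero hh h0 hx)
    (lintegral_condDensity hh h0 hx)

lemma measurable_condLaw_Iic (hh : Measurable h) (i : Fin n) :
    Measurable fun z : (Fin n → ℝ) × ℝ => (condLaw a h i z.1).real (Iic z.2) := by
  have : ∀ z : (Fin n → ℝ) × ℝ, (condLaw a h i z.1).real (Iic z.2) =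
      (∫⁻ t, {w : ((Fin n → ℝ) × ℝ) × ℝ | w.2 ≤ w.1.2}.indicator
        (fun w => condDensity a h i w.1.1 w.2) (z, t) ∂unitVolume (a i)).toReal := by
    intro z
    rw [measureReal_def, condLaw, withDensity_apply _ measurableSet_Iic,
      ← lintegral_indicator measurableSet_Iic]
    rfl
  simp_rw [this]
  refine ((Measurable.indicator ?_ ?_).lintegral_prod_right').ennreal_toReal
  · exact (measurable_condDensity_uncurry hh i).comp
      ((measurable_fst.comp measurable_fst).prodMk measurable_snd)
  · exact measurableSet_le measurable_snd (measurable_snd.comp measurable_fst)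

end Marginals

/-! ### The Knothe map -/

section Knothe

variable {n : ℕ} (a : Fin n → ℝ) (f g : (Fin n → ℝ) → ENNReal)

/-- Coordinate `i` of the Knothe map at `x`, given the previous coordinates `y` of the image: the
monotone transport between the conditional laws of `f` given `x` and of `g` given `y`. If the
conditional law of `g` is undefined because the marginal is infinite, the coordinate is kept. -/
noncomputable def knotheCoord (i : Fin n) (y x : Fin n → ℝ) : ℝ :=
  open Classical in
  if marg a g i y = ⊤ then x i
  else monoTransport (a i) (condLaw a f i x) (condLaw a g i y) (x i)

/-- The Knothe map between the densities `f` and `g` on the unit cube with lower corner `a`. -/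
noncomputable def knothe (x : Fin n → ℝ) (i : Fin n) : ℝ :=
  knotheCoord a f g i (fun j => if _h : j < i then knothe x j else 0) x
termination_by i.val

/-- The partial derivative of coordinate `i` of the Knothe map in direction `i`, as a quotient of
conditional densities; it is `1` where the map keeps the coordinate. -/
noncomputable def knotheDeriv (i : Fin n) (x : Fin n → ℝ) : ENNReal :=
  open Classical in
  if marg a g i (knothe a f g x) = ⊤ then 1
  else condDensity a f i x (x i) / condDensity a g i (knothe a f g x) (knothe a f g x i)

variable {a f g}

lemma knotheCoord_congr {i : Fin n} {y y' x x' : Fin n → ℝ} (hy : ∀ j < i, y j = y' j)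
    (hx : ∀ j ≤ i, x j = x' j) : knotheCoord a f g i y x = knotheCoord a f g i y' x' := by
  rw [knotheCoord, knotheCoord, dependsBelow_marg i y y' fun j hj => hy j hj,
    condLaw_congr hy, condLaw_congr fun j hj => hx j (le_of_lt hj), hx i le_rfl]

lemma knothe_eq (x : Fin n → ℝ) (i : Fin n) :
    knothe a f g x i = knotheCoord a f g i (knothe a f g x) x := by
  rw [knothe]
  exact knotheCoord_congr (fun j hj => by simp [hj]) fun _ _ => rfl

lemma knothe_congr (i : Fin n) {x x' : Fin n → ℝ} (hx : ∀ j ≤ i, x j = x' j) :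
    knothe a f g x i = knothe a f g x' i := by
  induction i using WellFoundedLT.induction with
  | ind i ih =>
    rw [knothe_eq, knothe_eq]
    exact knotheCoord_congr (fun j hj => ih j hj fun l hl => hx l (hl.trans hj.le)) hx

lemma knothe_update_of_lt {i j : Fin n} (hj : j < i) (x : Fin n → ℝ) (t : ℝ) :
    knothe a f g (Function.update x i t) j = knothe a f g x j :=
  knothe_congr j fun _ hl => Function.update_of_ne (hl.trans_lt hj).ne _ _

lemma marg_knothe_update (h : (Fin n → ℝ) → ENNReal) (i : Fin n) (x : Fin n → ℝ) (t : ℝ) :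
    marg a h i (knothe a f g (Function.update x i t)) = marg a h i (knothe a f g x) :=
  dependsBelow_marg _ _ _ fun _ hj => knothe_update_of_lt hj x t

lemma knothe_update_of_eq_top {i : Fin n} {x : Fin n → ℝ}
    (hx : marg a g i (knothe a f g x) = ⊤) (t : ℝ) :
    knothe a f g (Function.update x i t) i = t := by
  rw [knothe_eq, knotheCoord, marg_knothe_update, if_pos hx, Function.update_self]

lemma knothe_update_of_ne_top {i : Fin n} {x : Fin n → ℝ}
    (hx : marg a g i (knothe a f g x) ≠ ⊤) (t : ℝ) :
    knothe a f g (Function.update x i t) i =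
      monoTransport (a i) (condLaw a f i x) (condLaw a g i (knothe a f g x)) t := by
  rw [knothe_eq, knotheCoord, marg_knothe_update, if_neg hx, Function.update_self,
    condLaw_congr (y := x) fun j hj => Function.update_of_ne hj.ne _ _,
    condLaw_congr (y := knothe a f g x) fun j hj => knothe_update_of_lt hj x t]

variable {M : ENNReal} (hf : Measurable f) (hf0 : ∀ x, f x ≠ 0) (hM : M ≠ ⊤) (hfM : ∀ x, f x ≤ M)
  (hg : Measurable g) (hg0 : ∀ x, g x ≠ 0)
include hf hf0 hM hfM hg hg0

lemma strictMonoOn_knothe (i : Fin n) (x : Fin n → ℝ) :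
    StrictMonoOn (fun t => knothe a f g (Function.update x i t) i) (Icc (a i) (a i + 1)) := by
  by_cases hx : marg a g i (knothe a f g x) = ⊤
  · intro s _ t _ hst
    simpa only [knothe_update_of_eq_top hx] using hst
  · intro s hs t ht hst
    simp only [knothe_update_of_ne_top hx]
    exact strictMonoOn_monoTransport (isFullOn_condLaw hf hf0 (marg_ne_top hM hfM _ _))
      (isFullOn_condLaw hg hg0 hx) hs ht hst

lemma knothe_update_mem (i : Fin n) (x : Fin n → ℝ) {t : ℝ} (ht : t ∈ Icc (a i) (a i + 1)) :
    knothe a f g (Function.update x i t) i ∈ Icc (a i) (a i + 1) := by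
  by_cases hx : marg a g i (knothe a f g x) = ⊤
  · rwa [knothe_update_of_eq_top hx]
  · rw [knothe_update_of_ne_top hx]
    exact monoTransport_mem (isFullOn_condLaw hf hf0 (marg_ne_top hM hfM _ _))
      (isFullOn_condLaw hg hg0 hx) t

lemma knothe_mem {i : Fin n} {x : Fin n → ℝ} (hx : x i ∈ Icc (a i) (a i + 1)) :
    knothe a f g x i ∈ Icc (a i) (a i + 1) := by
  simpa using knothe_update_mem hf hf0 hM hfM hg hg0 i x hx

lemma measurable_knotheCoord (i : Fin n) :
    Measurable fun z : (Fin n → ℝ) × (Fin n → ℝ) => knotheCoord a f g i z.1 z.2 := by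
  have hTop : MeasurableSet {z : (Fin n → ℝ) × (Fin n → ℝ) | marg a g i z.1 = ⊤} :=
    (measurable_marg hg i).comp measurable_fst (measurableSet_singleton ⊤)
  have hxi : Measurable fun z : (Fin n → ℝ) × (Fin n → ℝ) => z.2 i :=
    (measurable_pi_apply i).comp measurable_snd
  have hp1 : Measurable fun z : (Fin n → ℝ) × (Fin n → ℝ) => (z.2, z.2 i) :=
    measurable_snd.prodMk hxi
  have hC1 := (measurable_condLaw_Iic (a := a) hf i).comp hp1
  have hp2 : ∀ c : ℝ, Measurable fun z : (Fin n → ℝ) × (Fin n → ℝ) => (z.1, c) := fun c =>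
    measurable_fst.prodMk measurable_const
  have hC2 := fun c : ℝ => (measurable_condLaw_Iic (a := a) hg i).comp (hp2 c)
  have hF := fun x => isFullOn_condLaw (a := a) (x := x) hf hf0 (marg_ne_top hM hfM i _)
  apply measurable_of_Iic
  intro c
  -- it suffices to treat the points at which the conditional law of `g` is defined
  have key : ∀ A : Set ((Fin n → ℝ) × (Fin n → ℝ)), MeasurableSet A →
      (∀ z, marg a g i z.1 ≠ ⊤ →
        (monoTransport (a i) (condLaw a f i z.2) (condLaw a g i z.1) (z.2 i) ≤ c ↔ z ∈ A)) →
      MeasurableSet ((fun z : (Fin n → ℝ) × (Fin n → ℝ) => knotheCoord a f g i z.1 z.2) ⁻¹'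
        Iic c) := by
    intro A hA hiff
    have : (fun z : (Fin n → ℝ) × (Fin n → ℝ) => knotheCoord a f g i z.1 z.2) ⁻¹' Iic c =
        ({z | marg a g i z.1 = ⊤} ∩ {z | z.2 i ≤ c}) ∪ ({z | marg a g i z.1 = ⊤}ᶜ ∩ A) := by
      ext z
      by_cases hz : marg a g i z.1 = ⊤
      · simp [knotheCoord, hz]
      · simp [knotheCoord, hz, hiff z hz]
    rw [this]
    exact (hTop.inter (hxi measurableSet_Iic)).union (hTop.compl.inter hA)
  rcases lt_or_ge c (a i) with hc | hc
  · refine key ∅ .empty fun z hz => ?_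
    simpa using hc.trans_le (monoTransport_mem (hF z.2) (isFullOn_condLaw hg hg0 hz) _).1
  rcases le_or_gt (a i + 1) c with hc' | hc'
  · refine key univ .univ fun z hz => ?_
    simpa using (monoTransport_mem (hF z.2) (isFullOn_condLaw hg hg0 hz) _).2.trans hc'
  · exact key _ (measurableSet_le hC1 (hC2 c)) fun z hz =>
      monoTransport_le_iff (hF z.2) (isFullOn_condLaw hg hg0 hz) ⟨hc, hc'.le⟩

lemma measurable_knothe : Measurable (knothe a f g) := by
  rw [measurable_pi_iff]
  intro i
  induction i using WellFoundedLT.induction with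
  | ind i ih =>
    have : (fun x => knothe a f g x i) = fun x =>
        knotheCoord a f g i (fun j => if j < i then knothe a f g x j else 0) x := by
      ext x
      rw [knothe_eq]
      exact knotheCoord_congr (fun j hj => by simp [hj]) fun _ _ => rfl
    have hy : Measurable fun x => (fun j => if j < i then knothe a f g x j else 0 : Fin n → ℝ) := by
      rw [measurable_pi_iff]
      intro j
      by_cases hj : j < i
      · simpa only [if_pos hj] using ih j hj
      · simp only [if_neg hj, measurable_const]
    rw [this]
    exact (measurable_knotheCoord hf hf0 hM hfM hg hg0 i).comp (hy.prodMk measurable_id)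

lemma measurable_knotheDeriv (i : Fin n) : Measurable (knotheDeriv a f g i) := by
  have hT := measurable_knothe (a := a) hf hf0 hM hfM hg hg0
  unfold knotheDeriv
  refine Measurable.ite ((measurable_marg hg i).comp hT (measurableSet_singleton ⊤))
    measurable_const (Measurable.div ?_ ?_)
  · exact (measurable_condDensity_uncurry hf i).comp
      (measurable_id.prodMk (measurable_pi_apply i))
  · exact (measurable_condDensity_uncurry hg i).comp
      (hT.prodMk ((measurable_pi_apply i).comp hT))

/-- Along every line parallel to the axis `i`, coordinate `i` of the Knothe map is absolutely
continuous with derivative `knotheDeriv`. -/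
lemma knothe_eq_integral (i : Fin n) (x : Fin n → ℝ) :
    knothe a f g (Function.update x i (a i + 1)) i = a i + 1 ∧
    IntervalIntegrable (fun t => (knotheDeriv a f g i (Function.update x i t)).toReal) volume
      (a i) (a i + 1) ∧
    ∀ s ∈ Icc (a i) (a i + 1), knothe a f g (Function.update x i s) i =
      a i + ∫ t in (a i)..s, (knotheDeriv a f g i (Function.update x i t)).toReal := by
  by_cases hx : marg a g i (knothe a f g x) = ⊤
  · simp [knothe_update_of_eq_top hx, knotheDeriv, marg_knothe_update, hx]
  · have hxf : marg a f i x ≠ ⊤ := marg_ne_top hM hfM _ _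
    have h := monoTransport_eq_integral (measurable_condDensity hf i x)
      (measurable_condDensity hg i (knothe a f g x)) (condDensity_ne_zero hf hf0 hxf)
      (condDensity_ne_zero hg hg0 hx) (lintegral_condDensity hf hf0 hxf)
      (lintegral_condDensity hg hg0 hx)
      (T := fun t => knothe a f g (Function.update x i t) i)
      (funext fun t => knothe_update_of_ne_top hx t)
    have hd : ∀ t, knotheDeriv a f g i (Function.update x i t) = condDensity a f i x t /
        condDensity a g i (knothe a f g x) (knothe a f g (Function.update x i t) i) := by
      intro t
      rw [knotheDeriv, marg_knothe_update, if_neg hx, Function.update_self, condDensity_update,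
        condDensity_congr (y := knothe a f g x) fun j hj => knothe_update_of_lt hj x t]
    simp only [hd]
    exact h

variable (hgfin : ∫⁻ x, g x ∂cubeVolume a ≠ ⊤)
include hgfin

/-- The transport property, by induction on the number of coordinates on which the test function
depends. The step integrates out the last of them by one-dimensional transport between the
conditional laws. -/
lemma lintegral_knothe_of_dependsBelow {k : ℕ} (hk : k ≤ n) {h : (Fin n → ℝ) → ENNReal}
    (hh : Measurable h) (hd : DependsBelow k h) :
    (∫⁻ x, h (knothe a f g x) * f x ∂cubeVolume a) * ∫⁻ x, g x ∂cubeVolume a =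
      (∫⁻ y, h y * g y ∂cubeVolume a) * ∫⁻ x, f x ∂cubeVolume a := by
  have hT := measurable_knothe (a := a) hf hf0 hM hfM hg hg0
  induction k generalizing h with
  | zero =>
    have hc : ∀ y, h y = h 0 := fun y => hd y 0 fun j hj => absurd hj (Nat.not_lt_zero _)
    simp_rw [hc]
    rw [lintegral_const_mul _ hf, lintegral_const_mul _ hg]
    ring
  | succ k ih =>
    set i : Fin n := ⟨k, hk⟩ with hi
    have hdT : ∀ {j : ℕ} {H : (Fin n → ℝ) → ENNReal}, DependsBelow j H →
        DependsBelow j fun x => H (knothe a f g x) := fun hH x y hxy =>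
      hH _ _ fun l hl => knothe_congr l fun m hm => hxy m (lt_of_le_of_lt hm hl)
    -- the conditional expectation of `h` under `g` given the first `k` coordinates
    set E : (Fin n → ℝ) → ENNReal := fun y =>
      ∫⁻ s, condDensity a g i y s * h (Function.update y i s) ∂unitVolume (a i) with hE
    have hEm : Measurable E :=
      ((measurable_condDensity_uncurry hg i).mul (hh.comp measurable_update')).lintegral_prod_right'
    have hEd : DependsBelow k E := by
      intro x y hxy
      simp only [hE]
      rw [condDensity_congr (y := y) fun j hj => hxy j hj]
      refine lintegral_congr fun s => ?_
      congr 1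
      apply hd
      intro j hj
      rcases eq_or_ne j i with rfl | hne
      · simp
      · rw [Function.update_of_ne hne, Function.update_of_ne hne]
        exact hxy j (lt_of_le_of_ne (Nat.lt_succ_iff.1 hj) fun he => hne (Fin.ext he))
    -- the fallback of `knotheCoord` is almost never used, by the transport property in the first
    -- `k` coordinates
    have hnull : ∀ᵐ x ∂cubeVolume a, marg a g i (knothe a f g x) ≠ ⊤ := by
      have hms : MeasurableSet {y | marg a g i y = ⊤} :=
        measurable_marg hg i (measurableSet_singleton ⊤)
      have h1 := ih (Nat.le_of_succ_le hk) (h := {y | marg a g i y = ⊤}.indicator 1)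
        (measurable_one.indicator hms) (by
          intro x y hxy
          have := dependsBelow_marg (a := a) (h := g) k x y hxy
          have h2 : x ∈ {y | marg a g i y = ⊤} ↔ y ∈ {y | marg a g i y = ⊤} := by
            change marg a g k x = ⊤ ↔ marg a g k y = ⊤
            rw [this]
          by_cases hx : x ∈ {y | marg a g i y = ⊤}
          · rw [indicator_of_mem hx, indicator_of_mem (h2.1 hx)]; rfl
          · rw [indicator_of_notMem hx, indicator_of_notMem (fun hy => hx (h2.2 hy))])
      exact ae_notMem_of_transport hf hf0 hg hg0 hT hms
        ((ae_marg_lt_top hg hgfin i).mono fun y hy => hy.ne) h1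
    have hL : ∫⁻ x, h (knothe a f g x) * f x ∂cubeVolume a =
        ∫⁻ x, E (knothe a f g x) * f x ∂cubeVolume a := by
      refine (lintegral_mul_marg hf (hh.comp hT) (hdT hd)).trans
        (Eq.trans ?_ (lintegral_mul_marg hf (hEm.comp hT) (hdT hEd)).symm)
      refine (lintegral_update ((hh.comp hT).mul (measurable_marg hf _)) i).trans ?_
      apply lintegral_congr_ae
      filter_upwards [hnull] with x hx
      have hxf : marg a f i x ≠ ⊤ := marg_ne_top hM hfM _ _
      have h1d := lintegral_monoTransport (measurable_condDensity hf i x)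
        (measurable_condDensity hg i (knothe a f g x)) (condDensity_ne_zero hf hf0 hxf)
        (condDensity_ne_zero hg hg0 hx) (lintegral_condDensity hf hf0 hxf)
        (lintegral_condDensity hg hg0 hx)
        (h := fun s => h (Function.update (knothe a f g x) i s))
        (hh.comp (measurable_update _))
      change _ = E (knothe a f g x) * marg a f i x
      simp only [hE]
      rw [← h1d, ← lintegral_mul_const' _ _ hxf]
      refine lintegral_congr fun t => ?_
      have e1 : h (knothe a f g (Function.update x i t)) = h (Function.update (knothe a f g x) i
          (monoTransport (a i) (condLaw a f i x) (condLaw a g i (knothe a f g x)) t)) := by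
        apply hd
        intro j hj
        rcases eq_or_ne j i with rfl | hne
        · rw [Function.update_self, knothe_update_of_ne_top hx]
        · rw [Function.update_of_ne hne]
          exact knothe_update_of_lt
            (lt_of_le_of_ne (Nat.lt_succ_iff.1 hj) fun he => hne (Fin.ext (Fin.ext_iff.1 he))) x t
      change h (knothe a f g (Function.update x i t)) * marg a f (i + 1) (Function.update x i t) = _
      rw [e1, condDensity, mul_right_comm, ENNReal.div_mul_cancel (marg_ne_zero hf hf0 _ _) hxf,
        mul_comm]
      rfl
    have hRr : ∫⁻ y, h y * g y ∂cubeVolume a = ∫⁻ y, E y * g y ∂cubeVolume a := by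
      rw [lintegral_mul_marg hg hh hd, lintegral_mul_marg hg hEm hEd]
      refine (lintegral_update (hh.mul (measurable_marg hg _)) i).trans ?_
      apply lintegral_congr_ae
      filter_upwards [ae_marg_lt_top hg hgfin i] with y hy
      change _ = E y * marg a g i y
      simp only [hE]
      rw [← lintegral_mul_const' _ _ hy.ne]
      refine lintegral_congr fun t => ?_
      rw [condDensity, mul_right_comm, ENNReal.div_mul_cancel (marg_ne_zero hg hg0 _ _) hy.ne,
        mul_comm]
      rfl
    rw [hL, hRr]
    exact ih (Nat.le_of_succ_le hk) hEm hEd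

lemma lintegral_knothe {h : (Fin n → ℝ) → ENNReal} (hh : Measurable h) :
    (∫⁻ x, h (knothe a f g x) * f x ∂cubeVolume a) * ∫⁻ x, g x ∂cubeVolume a =
      (∫⁻ y, h y * g y ∂cubeVolume a) * ∫⁻ x, f x ∂cubeVolume a :=
  lintegral_knothe_of_dependsBelow hf hf0 hM hfM hg hg0 hgfin le_rfl hh fun x y hxy => by
    rw [funext fun j => hxy j j.isLt]

lemma quasiMeasurePreserving_knothe :
    Measure.QuasiMeasurePreserving (knothe a f g) (cubeVolume a) (cubeVolume a) := by
  have hT := measurable_knothe (a := a) hf hf0 hM hfM hg hg0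
  refine ⟨hT, Measure.AbsolutelyContinuous.mk fun s hs hs0 => ?_⟩
  rw [Measure.map_apply hT hs, measure_eq_zero_iff_ae_notMem]
  exact ae_notMem_of_transport hf hf0 hg hg0 hT hs (measure_eq_zero_iff_ae_notMem.1 hs0)
    (lintegral_knothe hf hf0 hM hfM hg hg0 hgfin (measurable_one.indicator hs))

lemma ae_marg_knothe_lt_top :
    ∀ᵐ x ∂cubeVolume a, ∀ k, marg a g k (knothe a f g x) < ⊤ :=
  ae_all_iff.2 fun k => (quasiMeasurePreserving_knothe hf hf0 hM hfM hg hg0 hgfin).ae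
    (ae_marg_lt_top hg hgfin k)

omit hf hf0 hM hfM hg hg0 hgfin in
lemma toReal_knotheDeriv_eq {x : Fin n → ℝ} (hx : ∀ k, marg a g k (knothe a f g x) < ⊤)
    (i : Fin n) : (knotheDeriv a f g i x).toReal =
      ((marg a f (i + 1) x).toReal / (marg a f i x).toReal) /
      ((marg a g (i + 1) (knothe a f g x)).toReal / (marg a g i (knothe a f g x)).toReal) := by
  rw [knotheDeriv, if_neg (hx i).ne, condDensity, condDensity, Function.update_eq_self,
    Function.update_eq_self, ENNReal.toReal_div, ENNReal.toReal_div, ENNReal.toReal_div]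

lemma ae_toReal_knotheDeriv_pos (i : Fin n) :
    ∀ᵐ x ∂cubeVolume a, 0 < (knotheDeriv a f g i x).toReal := by
  filter_upwards [ae_marg_knothe_lt_top hf hf0 hM hfM hg hg0 hgfin] with x hx
  rw [toReal_knotheDeriv_eq hx]
  have h1 : ∀ k, 0 < (marg a f k x).toReal := fun k =>
    ENNReal.toReal_pos (marg_ne_zero hf hf0 _ _) (marg_ne_top hM hfM _ _)
  have h2 : ∀ k, 0 < (marg a g k (knothe a f g x)).toReal := fun k =>
    ENNReal.toReal_pos (marg_ne_zero hg hg0 _ _) (hx k).ne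
  exact div_pos (div_pos (h1 _) (h1 _)) (div_pos (h2 _) (h2 _))

/-- The change of variables formula, in logarithmic form; the sum telescopes over the marginals. -/
lemma ae_sum_log_knotheDeriv : ∀ᵐ x ∂cubeVolume a,
    ∑ i, Real.log (knotheDeriv a f g i x).toReal =
      (Real.log (f x).toReal - Real.log (∫⁻ x, f x ∂cubeVolume a).toReal) -
      (Real.log (g (knothe a f g x)).toReal - Real.log (∫⁻ x, g x ∂cubeVolume a).toReal) := by
  filter_upwards [ae_marg_knothe_lt_top hf hf0 hM hfM hg hg0 hgfin] with x hx
  have h1 : ∀ k, (marg a f k x).toReal ≠ 0 := fun k =>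
    (ENNReal.toReal_pos (marg_ne_zero hf hf0 _ _) (marg_ne_top hM hfM _ _)).ne'
  have h2 : ∀ k, (marg a g k (knothe a f g x)).toReal ≠ 0 := fun k =>
    (ENNReal.toReal_pos (marg_ne_zero hg hg0 _ _) (hx k).ne).ne'
  have h3 : ∀ i : Fin n, Real.log (knotheDeriv a f g i x).toReal =
      (fun k : ℕ => (Real.log (marg a f (k + 1) x).toReal - Real.log (marg a f k x).toReal) -
        (Real.log (marg a g (k + 1) (knothe a f g x)).toReal -
          Real.log (marg a g k (knothe a f g x)).toReal)) i := by
    intro i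
    rw [toReal_knotheDeriv_eq hx, Real.log_div (div_ne_zero (h1 _) (h1 _))
      (div_ne_zero (h2 _) (h2 _)), Real.log_div (h1 _) (h1 _), Real.log_div (h2 _) (h2 _)]
  simp_rw [h3]
  rw [Fin.sum_univ_eq_sum_range (fun k : ℕ =>
      (Real.log (marg a f (k + 1) x).toReal - Real.log (marg a f k x).toReal) -
        (Real.log (marg a g (k + 1) (knothe a f g x)).toReal -
          Real.log (marg a g k (knothe a f g x)).toReal)) n, Finset.sum_sub_distrib,
    Finset.sum_range_sub fun k => Real.log (marg a f k x).toReal,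
    Finset.sum_range_sub fun k => Real.log (marg a g k (knothe a f g x)).toReal,
    marg_self, marg_self, marg_zero, marg_zero]

end Knothe

/-! ### Maps of the cube that are absolutely continuous along the axes -/

section Cube

variable {n : ℕ} {a : Fin n → ℝ}

/-- Resampling one coordinate preserves the uniform measure of the cube. -/
lemma measurePreserving_update (i : Fin n) :
    MeasurePreserving (fun z : (Fin n → ℝ) × ℝ => Function.update z.1 i z.2)
      ((cubeVolume a).prod (unitVolume (a i))) (cubeVolume a) := by
  refine ⟨measurable_update', Measure.ext fun s hs => ?_⟩
  rw [Measure.map_apply measurable_update' hs, Measure.prod_apply (measurable_update' hs),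
    ← lintegral_indicator_one hs, lintegral_update (measurable_one.indicator hs) i]
  refine lintegral_congr fun x => ?_
  exact (lintegral_indicator_one (hs.preimage (measurable_update x))).symm

lemma integral_update {Φ : (Fin n → ℝ) → ℝ} (hΦm : Measurable Φ)
    (hΦ : Integrable Φ (cubeVolume a)) (i : Fin n) :
    ∫ x, Φ x ∂cubeVolume a =
      ∫ x, ∫ t, Φ (Function.update x i t) ∂unitVolume (a i) ∂cubeVolume a := by
  have hmp := measurePreserving_update (a := a) i
  have hi : Integrable (fun z : (Fin n → ℝ) × ℝ => Φ (Function.update z.1 i z.2))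
      ((cubeVolume a).prod (unitVolume (a i))) :=
    (hmp.integrable_comp hΦm.aestronglyMeasurable).2 hΦ
  rw [← integral_prod _ hi]
  conv_lhs => rw [← hmp.map_eq]
  exact integral_map hmp.measurable.aemeasurable hΦm.aestronglyMeasurable

lemma cubeVolume_eq_restrict :
    cubeVolume a = (volume : Measure (Fin n → ℝ)).restrict
      (univ.pi fun i => Ioo (a i) (a i + 1)) := by
  rw [volume_pi, Measure.restrict_pi_pi]
  rfl

lemma measurableSet_openCube : MeasurableSet (univ.pi fun i => Ioo (a i) (a i + 1)) :=
  MeasurableSet.univ_pi fun _ => measurableSet_Ioo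

lemma ae_mem_openCube : ∀ᵐ x ∂cubeVolume a, ∀ i, x i ∈ Ioo (a i) (a i + 1) := by
  rw [cubeVolume_eq_restrict]
  filter_upwards [ae_restrict_mem measurableSet_openCube] with x hx i using hx i (mem_univ i)

variable {p : EuclideanSpace ℝ (Fin n) → ℝ} {K : NNReal} {R : ℝ}
  {T : (Fin n → ℝ) → (Fin n → ℝ)} {τ : Fin n → (Fin n → ℝ) → ℝ}

lemma toLp_update_eq (y : Fin n → ℝ) (i : Fin n) (s : ℝ) :
    WithLp.toLp 2 (Function.update y i s) =
      WithLp.toLp 2 y + EuclideanSpace.single i (s - y i) := by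
  ext j
  rcases eq_or_ne j i with rfl | hne
  · simp
  · simp [hne]

lemma lipschitzWith_update (hp : LipschitzWith K p) (y : Fin n → ℝ) (i : Fin n) :
    LipschitzWith K fun t => p (WithLp.toLp 2 (Function.update y i t)) := by
  refine LipschitzWith.of_dist_le_mul fun s t => (hp.dist_le_mul _ _).trans_eq ?_
  congr 1
  rw [toLp_update_eq, toLp_update_eq, dist_add_left, PiLp.dist_single_same,
    Real.dist_eq, Real.dist_eq]
  ring_nf

lemma deriv_update_eq {y : Fin n → ℝ} {i : Fin n} {t : ℝ}
    (hd : DifferentiableAt ℝ p (WithLp.toLp 2 (Function.update y i t))) :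
    deriv (fun s => p (WithLp.toLp 2 (Function.update y i s))) t =
      fderiv ℝ p (WithLp.toLp 2 (Function.update y i t)) (EuclideanSpace.single i 1) := by
  have h1 : HasDerivAt (fun s : ℝ => WithLp.toLp 2 y + (s - y i) • EuclideanSpace.single i (1 : ℝ))
      (EuclideanSpace.single i (1 : ℝ)) t := by
    simpa using (((hasDerivAt_id t).sub_const (y i)).smul_const
      (EuclideanSpace.single i (1 : ℝ))).const_add (WithLp.toLp 2 y)
  have h2 : (fun s : ℝ => WithLp.toLp 2 (Function.update y i s)) =
      fun s => WithLp.toLp 2 y + (s - y i) • EuclideanSpace.single i (1 : ℝ) := by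
    ext1 s
    rw [toLp_update_eq]
    ext j
    rcases eq_or_ne j i with rfl | hne
    · simp
    · simp [hne]
  rw [← h2] at h1
  exact (hd.hasFDerivAt.comp_hasDerivAt t h1).deriv

lemma ae_differentiableAt_toLp (hp : LipschitzWith K p) :
    ∀ᵐ y ∂cubeVolume a, DifferentiableAt ℝ p (WithLp.toLp 2 y) := by
  rw [cubeVolume_eq_restrict]
  exact ae_restrict_of_ae
    ((PiLp.volume_preserving_toLp (Fin n)).quasiMeasurePreserving.ae hp.ae_differentiableAt)

variable (hp : LipschitzWith K p)
  (hTm : Measurable T) (hτm : ∀ i, Measurable (τ i))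
  (hTend : ∀ i x, T (Function.update x i (a i + 1)) i = a i + 1)
  (hτi : ∀ i x, IntervalIntegrable (fun t => τ i (Function.update x i t)) volume (a i) (a i + 1))
  (hTτ : ∀ i x, ∀ s ∈ Icc (a i) (a i + 1),
    T (Function.update x i s) i = a i + ∫ t in (a i)..s, τ i (Function.update x i t))
  (hTmem : ∀ i x, x i ∈ Icc (a i) (a i + 1) → T x i ∈ Icc (a i) (a i + 1))
  (hτ0 : ∀ i x, 0 ≤ τ i x)

include hτm hTend hτi hTτ hτ0 in
lemma integrable_partialDeriv (i : Fin n) : Integrable (τ i) (cubeVolume a) := by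
  refine ⟨(hτm i).aestronglyMeasurable, ?_⟩
  rw [hasFiniteIntegral_iff_ofReal (ae_of_all _ (hτ0 i)),
    lintegral_update (hτm i).ennreal_ofReal i]
  have hle : a i ≤ a i + 1 := by linarith
  have : ∀ x, ∫⁻ t, ENNReal.ofReal (τ i (Function.update x i t)) ∂unitVolume (a i) = 1 := by
    intro x
    have h1 := hτi i x
    rw [intervalIntegrable_iff_integrableOn_Ioo_of_le hle] at h1
    rw [unitVolume, ← ofReal_integral_eq_lintegral_ofReal h1 (ae_of_all _ fun t => hτ0 i _),
      ← integral_Ioc_eq_integral_Ioo, ← intervalIntegral.integral_of_le hle]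
    have h2 := hTτ i x (a i + 1) (right_mem_Icc.2 hle)
    rw [hTend] at h2
    rw [show ∫ t in (a i)..(a i + 1), τ i (Function.update x i t) = 1 by linarith]
    simp
  simp [this]

include hp hTm hτm hTend hτi hTτ hTmem hτ0 in
/-- The weighted divergence `∂ᵢp (Tᵢ - xᵢ) + p (τᵢ - 1)` of the `i`-th displacement is integrable
and its integral vanishes. -/
lemma integral_divergence (i : Fin n) {B : ℝ}
    (hB : ∀ y, (∀ j, y j ∈ Ioo (a j) (a j + 1)) → |p (WithLp.toLp 2 y)| ≤ B) :
    Integrable (fun y => fderiv ℝ p (WithLp.toLp 2 y) (EuclideanSpace.single i 1) * (T y i - y i) +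
      p (WithLp.toLp 2 y) * (τ i y - 1)) (cubeVolume a) ∧
    ∫ y, (fderiv ℝ p (WithLp.toLp 2 y) (EuclideanSpace.single i 1) * (T y i - y i) +
      p (WithLp.toLp 2 y) * (τ i y - 1)) ∂cubeVolume a = 0 := by
  have hle : a i ≤ a i + 1 := by linarith
  have htoLp : Measurable (WithLp.toLp 2 : (Fin n → ℝ) → EuclideanSpace ℝ (Fin n)) :=
    (PiLp.volume_preserving_toLp (Fin n)).measurable
  have hDm : Measurable fun y : Fin n → ℝ =>
      fderiv ℝ p (WithLp.toLp 2 y) (EuclideanSpace.single i 1) :=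
    (measurable_fderiv_apply_const ℝ p _).comp htoLp
  have hpm : Measurable fun y : Fin n → ℝ => p (WithLp.toLp 2 y) :=
    hp.continuous.measurable.comp htoLp
  have hum : Measurable fun y : Fin n → ℝ => T y i - y i :=
    ((measurable_pi_apply i).comp hTm).sub (measurable_pi_apply i)
  have hm : Measurable fun y => fderiv ℝ p (WithLp.toLp 2 y) (EuclideanSpace.single i 1) *
      (T y i - y i) + p (WithLp.toLp 2 y) * (τ i y - 1) :=
    (hDm.mul hum).add (hpm.mul ((hτm i).sub_const 1))
  have hint : Integrable (fun y => fderiv ℝ p (WithLp.toLp 2 y) (EuclideanSpace.single i 1) *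
      (T y i - y i) + p (WithLp.toLp 2 y) * (τ i y - 1)) (cubeVolume a) := by
    refine Integrable.add ?_ ?_
    · refine Integrable.of_bound (hDm.mul hum).aestronglyMeasurable (K * 1) ?_
      filter_upwards [ae_mem_openCube (a := a)] with y hy
      have h1 := hTmem i y (Ioo_subset_Icc_self (hy i))
      have h2 : ‖fderiv ℝ p (WithLp.toLp 2 y) (EuclideanSpace.single i (1 : ℝ))‖ ≤ K := by
        refine ((fderiv ℝ p _).le_opNorm _).trans ?_
        rw [PiLp.norm_single, norm_one, mul_one]
        exact norm_fderiv_le_of_lipschitz ℝ hp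
      have h3 : ‖T y i - y i‖ ≤ 1 := by
        rw [Real.norm_eq_abs, abs_le]
        have := hy i
        constructor <;> linarith [this.1, this.2, h1.1, h1.2]
      rw [norm_mul]
      exact mul_le_mul h2 h3 (norm_nonneg _) K.coe_nonneg
    · refine Integrable.bdd_mul (c := B) ?_ hpm.aestronglyMeasurable ?_
      · exact (integrable_partialDeriv hτm hTend hτi hTτ hτ0 i).sub (integrable_const 1)
      · filter_upwards [ae_mem_openCube (a := a)] with y hy using hB y hy
  refine ⟨hint, ?_⟩
  rw [integral_update hm hint i]
  apply integral_eq_zero_of_ae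
  filter_upwards [ae_update (ae_differentiableAt_toLp (a := a) hp) i] with y hy
  have hline := integral_deriv_mul_displacement (a := a i) (lipschitzWith_update hp y i)
    (hτi i y) (hTτ i y) (hTend i y)
  rw [intervalIntegral.integral_of_le hle, integral_Ioc_eq_integral_Ioo] at hline
  rw [Pi.zero_apply, ← hline]
  apply integral_congr_ae
  filter_upwards [hy] with t ht
  rw [deriv_update_eq ht, Function.update_self]

include hp hTm hτm hTend hτi hTτ hTmem in
/-- The one-dimensional transportation cost inequality, integrated over all lines parallel to an
axis. -/
lemma lintegral_coord_sq_le (hR : 1 ≤ R) (i : Fin n)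
    (hpos : ∀ y, (∀ j, y j ∈ Ioo (a j) (a j + 1)) → 0 ≤ p (WithLp.toLp 2 y))
    (hconv : ∀ y, (∀ j, y j ∈ Ioo (a j) (a j + 1)) → ∀ s ∈ Ioo (a i) (a i + 1),
      ∀ t ∈ Ioo (a i) (a i + 1), ∀ l : ℝ, 0 < l → l < 1 →
      p (WithLp.toLp 2 (Function.update y i (l * s + (1 - l) * t))) ≤
        R * (l * p (WithLp.toLp 2 (Function.update y i s)) +
          (1 - l) * p (WithLp.toLp 2 (Function.update y i t))))
    (hτpos : ∀ᵐ y ∂cubeVolume a, 0 < τ i y) :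
    ∫⁻ y, ENNReal.ofReal ((T y i - y i) ^ 2 * p (WithLp.toLp 2 y)) ∂cubeVolume a ≤
      ENNReal.ofReal (4 * R ^ 2) * ∫⁻ y, ENNReal.ofReal
        (p (WithLp.toLp 2 y) * (τ i y - 1 - Real.log (τ i y))) ∂cubeVolume a := by
  have htoLp : Measurable (WithLp.toLp 2 : (Fin n → ℝ) → EuclideanSpace ℝ (Fin n)) :=
    (PiLp.volume_preserving_toLp (Fin n)).measurable
  have hpm : Measurable fun y : Fin n → ℝ => p (WithLp.toLp 2 y) :=
    hp.continuous.measurable.comp htoLp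
  have hum : Measurable fun y : Fin n → ℝ => T y i - y i :=
    ((measurable_pi_apply i).comp hTm).sub (measurable_pi_apply i)
  have hm1 : Measurable fun y => ENNReal.ofReal ((T y i - y i) ^ 2 * p (WithLp.toLp 2 y)) :=
    ((hum.pow_const 2).mul hpm).ennreal_ofReal
  have hm2 : Measurable fun y => ENNReal.ofReal
      (p (WithLp.toLp 2 y) * (τ i y - 1 - Real.log (τ i y))) :=
    (hpm.mul (((hτm i).sub_const 1).sub (hτm i).log)).ennreal_ofReal
  rw [lintegral_update hm1 i, lintegral_update hm2 i, ← lintegral_const_mul' _ _ ENNReal.ofReal_ne_top]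
  apply lintegral_mono_ae
  filter_upwards [ae_mem_openCube (a := a), ae_update hτpos i] with y hy hτy
  have hcube : ∀ t ∈ Ioo (a i) (a i + 1), ∀ j, Function.update y i t j ∈ Ioo (a j) (a j + 1) := by
    intro t ht j
    rcases eq_or_ne j i with rfl | hne
    · simpa using ht
    · simpa [hne] using hy j
  have := lintegral_displacement_sq_le (a := a i) (R := R) hR
    (lipschitzWith_update hp y i).continuous (fun t ht => hpos _ (hcube t ht)) (hconv y hy)
    (hτi i y) hτy (hTτ i y) (hTend i y) (fun s hs => hTmem i _ (by simpa using hs))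
  simpa only [Function.update_self, unitVolume] using this

end Cube

/-! ### Extended integrals -/

/-- The extended integral of the sum of a non-negative and an integrable function. -/
lemma lintegral_sub_lintegral_neg_eq {α : Type*} [MeasurableSpace α] {μ : Measure α}
    {S A B : α → ℝ} (hS : ∀ᵐ x ∂μ, S x = A x + B x) (hA0 : ∀ᵐ x ∂μ, 0 ≤ A x)
    (hA : AEMeasurable A μ) (hB : Integrable B μ) :
    ∫⁻ x, ENNReal.ofReal (-S x) ∂μ ≠ ⊤ ∧
    ((∫⁻ x, ENNReal.ofReal (S x) ∂μ : ENNReal) : EReal) -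
      ((∫⁻ x, ENNReal.ofReal (-S x) ∂μ : ENNReal) : EReal) =
      ((∫⁻ x, ENNReal.ofReal (A x) ∂μ : ENNReal) : EReal) + ((∫ x, B x ∂μ : ℝ) : EReal) := by
  have hSm : AEMeasurable S μ := (hA.add hB.aemeasurable).congr (hS.mono fun x hx => hx.symm)
  have hb1 : ∫⁻ x, ENNReal.ofReal (B x) ∂μ ≠ ⊤ := hB.lintegral_lt_top.ne
  have hb2 : ∫⁻ x, ENNReal.ofReal (-B x) ∂μ ≠ ⊤ := hB.neg.lintegral_lt_top.ne
  have hY : ∫⁻ x, ENNReal.ofReal (-S x) ∂μ ≠ ⊤ := by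
    refine ne_top_of_le_ne_top hb2 (lintegral_mono_ae ?_)
    filter_upwards [hS, hA0] with x h1 h2
    exact ENNReal.ofReal_le_ofReal (by linarith)
  refine ⟨hY, ?_⟩
  -- integrate `S⁺ + B⁻ = A + B⁺ + S⁻`, in which all terms are non-negative
  have hsum : ∫⁻ x, ENNReal.ofReal (S x) ∂μ + ∫⁻ x, ENNReal.ofReal (-B x) ∂μ =
      ∫⁻ x, ENNReal.ofReal (A x) ∂μ + ∫⁻ x, ENNReal.ofReal (B x) ∂μ +
        ∫⁻ x, ENNReal.ofReal (-S x) ∂μ := by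
    have hAB : AEMeasurable (fun x => ENNReal.ofReal (A x) + ENNReal.ofReal (B x)) μ :=
      hA.ennreal_ofReal.add hB.aemeasurable.ennreal_ofReal
    rw [← lintegral_add_left' hSm.ennreal_ofReal, ← lintegral_add_left' hA.ennreal_ofReal,
      ← lintegral_add_left' hAB]
    apply lintegral_congr_ae
    filter_upwards [hS, hA0] with x h1 h2
    rcases le_total 0 (B x) with h3 | h3 <;> rcases le_total 0 (S x) with h4 | h4
    · rw [ENNReal.ofReal_of_nonpos (neg_nonpos.2 h3), ENNReal.ofReal_of_nonpos (neg_nonpos.2 h4),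
        ← ENNReal.ofReal_add h2 h3, h1]
    · rw [ENNReal.ofReal_of_nonpos (neg_nonpos.2 h3), ENNReal.ofReal_of_nonpos h4,
        ← ENNReal.ofReal_add h2 h3, ← ENNReal.ofReal_add (by linarith) (by linarith), h1]
      simp
    · rw [ENNReal.ofReal_of_nonpos h3, ENNReal.ofReal_of_nonpos (neg_nonpos.2 h4),
        ← ENNReal.ofReal_add h4 (by linarith), h1]
      simp
    · rw [ENNReal.ofReal_of_nonpos h3, ENNReal.ofReal_of_nonpos h4, add_zero,
        ← ENNReal.ofReal_add h2 (by linarith), zero_add, h1]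
      congr 1
      ring
  rw [integral_eq_lintegral_pos_part_sub_lintegral_neg_part hB]
  generalize ∫⁻ x, ENNReal.ofReal (S x) ∂μ = X at hsum ⊢
  generalize ∫⁻ x, ENNReal.ofReal (-S x) ∂μ = Y at hsum hY ⊢
  generalize ∫⁻ x, ENNReal.ofReal (A x) ∂μ = Z at hsum ⊢
  generalize ∫⁻ x, ENNReal.ofReal (B x) ∂μ = b at hsum hb1 ⊢
  generalize ∫⁻ x, ENNReal.ofReal (-B x) ∂μ = c at hsum hb2 ⊢
  lift Y to NNReal using hY
  lift b to NNReal using hb1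
  lift c to NNReal using hb2
  induction Z with
  | top =>
    have hX : X = ⊤ := by
      rw [top_add, top_add, ENNReal.add_eq_top] at hsum
      exact hsum.resolve_right ENNReal.coe_ne_top
    rw [hX, EReal.coe_ennreal_top, EReal.coe_nnreal_eq_coe_real, EReal.top_sub_coe,
      EReal.top_add_coe]
  | coe Z =>
    have hX : X ≠ ⊤ := by
      intro h
      rw [h, top_add] at hsum
      exact absurd hsum.symm (by norm_cast)
    lift X to NNReal using hX
    have hr : (X : ℝ) + c = Z + b + Y := by exact_mod_cast hsum
    simp only [EReal.coe_nnreal_eq_coe_real, ENNReal.coe_toReal]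
    rw [← EReal.coe_sub, ← EReal.coe_add]
    congr 1
    linarith

/-! ### Functions on a unit cube in Euclidean space -/

section Euclidean

variable {n : ℕ} {a : Fin n → ℝ} {Q : Set (EuclideanSpace ℝ (Fin n))}

/-- The open and the closed cube are treated together: a unit cube lies between the open and the
closed cube with the same corner. -/
lemma IsUnitCube.exists_corner (hQ : IsUnitCube Q) : MeasurableSet Q ∧ ∃ a : Fin n → ℝ,
    (∀ x : EuclideanSpace ℝ (Fin n), (∀ i, x i ∈ Ioo (a i) (a i + 1)) → x ∈ Q) ∧
    ∀ x ∈ Q, ∀ i, x i ∈ Icc (a i) (a i + 1) := by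
  have hm : ∀ i, Measurable fun x : EuclideanSpace ℝ (Fin n) => x i := fun i => by fun_prop
  obtain ⟨a, rfl | rfl⟩ := hQ
  · refine ⟨?_, a, fun x hx => hx, fun x hx i => ⟨(hx i).1.le, (hx i).2.le⟩⟩
    have : {x : EuclideanSpace ℝ (Fin n) | ∀ i, a i < x i ∧ x i < a i + 1} =
        ⋂ i, (fun x => x i) ⁻¹' Ioo (a i) (a i + 1) := by ext; simp
    rw [this]
    exact MeasurableSet.iInter fun i => hm i measurableSet_Ioo
  · refine ⟨?_, a, fun x hx i => ⟨(hx i).1.le, (hx i).2.le⟩, fun x hx => hx⟩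
    have : {x : EuclideanSpace ℝ (Fin n) | ∀ i, a i ≤ x i ∧ x i ≤ a i + 1} =
        ⋂ i, (fun x => x i) ⁻¹' Icc (a i) (a i + 1) := by ext; simp
    rw [this]
    exact MeasurableSet.iInter fun i => hm i measurableSet_Icc

variable (hQ1 : ∀ x : EuclideanSpace ℝ (Fin n), (∀ i, x i ∈ Ioo (a i) (a i + 1)) → x ∈ Q)
  (hQ2 : ∀ x ∈ Q, ∀ i, x i ∈ Icc (a i) (a i + 1))
include hQ1 hQ2

lemma mem_closure_cube_iff {x : EuclideanSpace ℝ (Fin n)} :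
    x ∈ closure Q ↔ ∀ i, x i ∈ Icc (a i) (a i + 1) := by
  have hlt : ∀ i, a i < a i + 1 := fun i => by linarith
  have hcl : closure ((WithLp.ofLp : EuclideanSpace ℝ (Fin n) → (Fin n → ℝ)) ⁻¹'
      univ.pi fun i => Ioo (a i) (a i + 1)) =
      WithLp.ofLp ⁻¹' univ.pi fun i => Icc (a i) (a i + 1) := by
    have h := (EuclideanSpace.equiv (Fin n) ℝ).toHomeomorph.preimage_closure
      (univ.pi fun i => Ioo (a i) (a i + 1))
    rw [closure_pi_set] at h
    simp only [closure_Ioo (hlt _).ne] at h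
    exact h.symm
  constructor
  · intro hx
    have hsub : closure Q ⊆ WithLp.ofLp ⁻¹' univ.pi fun i => Icc (a i) (a i + 1) := by
      refine closure_minimal (fun y hy i _ => hQ2 y hy i) ?_
      rw [← hcl]
      exact isClosed_closure
    exact fun i => hsub hx i (mem_univ i)
  · intro hx
    have h1 : x ∈ closure ((WithLp.ofLp : EuclideanSpace ℝ (Fin n) → (Fin n → ℝ)) ⁻¹'
        univ.pi fun i => Ioo (a i) (a i + 1)) := by
      rw [hcl]
      exact fun i _ => hx i
    refine closure_mono ?_ h1
    exact fun y hy => hQ1 y fun i => hy i (mem_univ i)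

lemma measurePreserving_ofLp_cube :
    MeasurePreserving (WithLp.ofLp : EuclideanSpace ℝ (Fin n) → (Fin n → ℝ))
      (volume.restrict Q) (cubeVolume a) := by
  have hmp := PiLp.volume_preserving_ofLp (Fin n)
  have hQae : Q =ᵐ[volume] WithLp.ofLp ⁻¹' univ.pi fun i => Ioo (a i) (a i + 1) := by
    have h1 : (univ.pi fun i => Ioo (a i) (a i + 1)) =ᵐ[volume]
        univ.pi fun i => Icc (a i) (a i + 1) := by
      have h := Measure.univ_pi_Ioo_ae_eq_Icc (μ := fun _ : Fin n => (volume : Measure ℝ)) (f := a)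
        (g := fun i => a i + 1)
      rw [← pi_univ_Icc] at h
      exact h
    have h2 := hmp.quasiMeasurePreserving.preimage_ae_eq h1
    refine Filter.EventuallyLE.antisymm ?_ ?_
    · refine Filter.EventuallyLE.trans_eq (LE.le.eventuallyLE ?_) h2.symm
      exact fun x hx i _ => hQ2 x hx i
    · exact LE.le.eventuallyLE fun x hx => hQ1 x fun i => hx i (mem_univ i)
  rw [Measure.restrict_congr_set hQae, cubeVolume_eq_restrict]
  exact hmp.restrict_preimage measurableSet_openCube

lemma setLIntegral_cube_eq (φ : EuclideanSpace ℝ (Fin n) → ENNReal) :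
    ∫⁻ x in Q, φ x = ∫⁻ y, φ (WithLp.toLp 2 y) ∂cubeVolume a :=
  (measurePreserving_ofLp_cube hQ1 hQ2).lintegral_comp_emb
    (MeasurableEquiv.toLp 2 (Fin n → ℝ)).symm.measurableEmbedding
    fun y => φ (WithLp.toLp 2 y)

lemma ae_cube_iff {P : EuclideanSpace ℝ (Fin n) → Prop} :
    (∀ᵐ x ∂volume.restrict Q, P x) ↔ ∀ᵐ y ∂cubeVolume a, P (WithLp.toLp 2 y) := by
  rw [← (measurePreserving_ofLp_cube hQ1 hQ2).map_eq]
  exact ((MeasurableEquiv.toLp 2 (Fin n → ℝ)).symm.measurableEmbedding.ae_map_iff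
    (p := fun y => P (WithLp.toLp 2 y))).symm

/-- Integrals of a function supported on the cube, expressed by any density that represents it. -/
lemma setIntegral_eq_toReal (hQm : MeasurableSet Q) {φ : EuclideanSpace ℝ (Fin n) → ℝ}
    (h0 : ∀ x ∈ Q, 0 ≤ φ x) (hz : ∀ x ∉ Q, φ x = 0) (hm : AEMeasurable φ (volume.restrict Q))
    {Φ : (Fin n → ℝ) → ENNReal}
    (hΦ : ∀ᵐ y ∂cubeVolume a, Φ y = ENNReal.ofReal (φ (WithLp.toLp 2 y)))
    {s : Set (EuclideanSpace ℝ (Fin n))} (hs : MeasurableSet s) :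
    ∫ x in s, φ x =
      (∫⁻ y, (WithLp.toLp 2 ⁻¹' s).indicator 1 y * Φ y ∂cubeVolume a).toReal := by
  have h1 : ∀ᵐ x ∂volume.restrict Q, 0 ≤ s.indicator φ x := by
    filter_upwards [ae_restrict_mem hQm] with x hx
    by_cases hxs : x ∈ s <;> simp [hxs, h0 x hx]
  rw [← integral_indicator hs, ← setIntegral_eq_integral_of_forall_compl_eq_zero (s := Q)
    (fun x hx => by by_cases hxs : x ∈ s <;> simp [hxs, hz x hx]),
    integral_eq_lintegral_of_nonneg_ae h1 (hm.indicator hs).aestronglyMeasurable,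
    setLIntegral_cube_eq hQ1 hQ2]
  congr 1
  apply lintegral_congr_ae
  filter_upwards [hΦ] with y hy
  by_cases hys : WithLp.toLp 2 y ∈ s
  · rw [indicator_of_mem hys, indicator_of_mem (show y ∈ WithLp.toLp 2 ⁻¹' s from hys), hy]
    simp
  · rw [indicator_of_notMem hys, indicator_of_notMem (show y ∉ WithLp.toLp 2 ⁻¹' s from hys)]
    simp

omit hQ2 in
/-- A continuous function that is positive on the cube agrees on the open cube with a bounded,
everywhere positive density. -/
lemma exists_bounded_density {p : EuclideanSpace ℝ (Fin n) → ℝ} (hp : Continuous p)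
    (hpos : ∀ x ∈ Q, 0 < p x) : ∃ F : (Fin n → ℝ) → ENNReal, Measurable F ∧ (∀ y, F y ≠ 0) ∧
      (∃ M, M ≠ ⊤ ∧ ∀ y, F y ≤ M) ∧
      ∀ y, (∀ i, y i ∈ Ioo (a i) (a i + 1)) → F y = ENNReal.ofReal (p (WithLp.toLp 2 y)) := by
  classical
  have hpc : Continuous fun y : Fin n → ℝ => p (WithLp.toLp 2 y) :=
    hp.comp (PiLp.continuous_toLp 2 _)
  obtain ⟨B, hB⟩ := (isCompact_univ_pi fun i => isCompact_Icc (a := a i)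
    (b := a i + 1)).exists_bound_of_continuousOn hpc.continuousOn
  set C : Set (Fin n → ℝ) := univ.pi fun i => Ioo (a i) (a i + 1) with hC
  refine ⟨C.piecewise (fun y => ENNReal.ofReal (p (WithLp.toLp 2 y))) 1,
    hpc.measurable.ennreal_ofReal.piecewise measurableSet_openCube measurable_one, fun y => ?_,
    ⟨max (ENNReal.ofReal B) 1, by simp, fun y => ?_⟩, fun y hy => ?_⟩
  · by_cases hy : y ∈ C
    · rw [piecewise_eq_of_mem _ _ _ hy]
      exact (ENNReal.ofReal_pos.2 (hpos _ (hQ1 _ fun i => hy i (mem_univ i)))).ne'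
    · rw [piecewise_eq_of_notMem _ _ _ hy]
      exact one_ne_zero
  · by_cases hy : y ∈ C
    · rw [piecewise_eq_of_mem _ _ _ hy]
      refine le_max_of_le_left (ENNReal.ofReal_le_ofReal ?_)
      exact (le_abs_self _).trans (hB y fun i hi => Ioo_subset_Icc_self (hy i hi))
    · rw [piecewise_eq_of_notMem _ _ _ hy]
      exact le_max_right _ _
  · exact piecewise_eq_of_mem _ _ _ fun i _ => hy i

/-- An integrable function that is positive on the cube agrees almost everywhere with a
measurable, everywhere positive density. -/
lemma exists_positive_density {g : EuclideanSpace ℝ (Fin n) → ℝ}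
    (hQm : MeasurableSet Q) (hpos : ∀ x ∈ Q, 0 < g x) (hg : AEMeasurable g (volume.restrict Q)) :
    ∃ G : (Fin n → ℝ) → ENNReal, Measurable G ∧ (∀ y, G y ≠ 0) ∧
      ∀ᵐ y ∂cubeVolume a, G y = ENNReal.ofReal (g (WithLp.toLp 2 y)) := by
  classical
  have htoLp : Measurable (WithLp.toLp 2 : (Fin n → ℝ) → EuclideanSpace ℝ (Fin n)) :=
    (PiLp.volume_preserving_toLp (Fin n)).measurable
  have hm : Measurable fun y : Fin n → ℝ => hg.mk g (WithLp.toLp 2 y) := hg.measurable_mk.comp htoLp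
  refine ⟨fun y => if 0 < hg.mk g (WithLp.toLp 2 y) then
    ENNReal.ofReal (hg.mk g (WithLp.toLp 2 y)) else 1,
    Measurable.ite (measurableSet_lt measurable_const hm) hm.ennreal_ofReal measurable_const,
    fun y => ?_, ?_⟩
  · beta_reduce
    split_ifs with h
    · exact (ENNReal.ofReal_pos.2 h).ne'
    · exact one_ne_zero
  · refine (ae_cube_iff hQ1 hQ2 (P := fun x => (if 0 < hg.mk g x then
      ENNReal.ofReal (hg.mk g x) else 1) = ENNReal.ofReal (g x))).1 ?_
    filter_upwards [hg.ae_eq_mk, ae_restrict_mem hQm] with x hx hxQ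
    rw [← hx, if_pos (hpos x hxQ)]

end Euclidean

/-! ### The Knothe map between functions on a cube -/

section Transfer

variable {n : ℕ} {a : Fin n → ℝ} {Q : Set (EuclideanSpace ℝ (Fin n))}
  {f g : EuclideanSpace ℝ (Fin n) → ℝ} {F G : (Fin n → ℝ) → ENNReal} {M : ENNReal}

/-- The Knothe map between two densities, as a map of Euclidean space. -/
noncomputable def euclideanKnothe (a : Fin n → ℝ) (F G : (Fin n → ℝ) → ENNReal)
    (x : EuclideanSpace ℝ (Fin n)) : EuclideanSpace ℝ (Fin n) :=
  WithLp.toLp 2 (knothe a F G (WithLp.ofLp x))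

variable (hQ1 : ∀ x : EuclideanSpace ℝ (Fin n), (∀ i, x i ∈ Ioo (a i) (a i + 1)) → x ∈ Q)
  (hQ2 : ∀ x ∈ Q, ∀ i, x i ∈ Icc (a i) (a i + 1)) (hQm : MeasurableSet Q)
  (hf_pos : ∀ x ∈ Q, 0 < f x) (hf_zero : ∀ x ∉ Q, f x = 0)
  (hg_pos : ∀ x ∈ Q, 0 < g x) (hg_zero : ∀ x ∉ Q, g x = 0)
  (hF : Measurable F) (hF0 : ∀ x, F x ≠ 0) (hM : M ≠ ⊤) (hFM : ∀ x, F x ≤ M)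
  (hG : Measurable G) (hG0 : ∀ x, G x ≠ 0) (hGfin : ∫⁻ x, G x ∂cubeVolume a ≠ ⊤)
  (hFf : ∀ᵐ y ∂cubeVolume a, F y = ENNReal.ofReal (f (WithLp.toLp 2 y)))
  (hGg : ∀ᵐ y ∂cubeVolume a, G y = ENNReal.ofReal (g (WithLp.toLp 2 y)))

lemma support_eq_of_pos (hpos : ∀ x ∈ Q, 0 < f x) (hzero : ∀ x ∉ Q, f x = 0) :
    Function.support f = Q := by
  ext x
  by_cases hx : x ∈ Q
  · simp [hx, (hpos x hx).ne']
  · simp [hx, hzero x hx]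

include hQ1 hQ2 hQm hf_pos hf_zero hg_pos hg_zero hF hF0 hM hFM hG hG0 hGfin hFf hGg

lemma isTransportMap_euclideanKnothe (hfm : AEMeasurable f (volume.restrict Q))
    (hgm : AEMeasurable g (volume.restrict Q)) :
    IsTransportMap f g (euclideanKnothe a F G) := by
  have hKm : Measurable (knothe a F G) := measurable_knothe hF hF0 hM hFM hG hG0
  have hTm : Measurable (euclideanKnothe a F G) :=
    ((PiLp.volume_preserving_toLp (Fin n)).measurable.comp hKm).comp
      (PiLp.volume_preserving_ofLp (Fin n)).measurable
  have htoLp : Measurable (WithLp.toLp 2 : (Fin n → ℝ) → EuclideanSpace ℝ (Fin n)) :=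
    (PiLp.volume_preserving_toLp (Fin n)).measurable
  have hFfin : ∫⁻ y, F y ∂cubeVolume a ≠ ⊤ := by
    rw [← marg_zero (0 : Fin n → ℝ)]; exact marg_ne_top hM hFM _ _
  rw [IsTransportMap, support_eq_of_pos hf_pos hf_zero, support_eq_of_pos hg_pos hg_zero]
  refine ⟨hTm, fun x hx => ?_, fun A hA hAQ => ?_⟩
  · rw [mem_closure_cube_iff hQ1 hQ2] at hx ⊢
    exact fun i => knothe_mem hF hF0 hM hFM hG hG0 (hx i)
  · have hf0 : ∀ x ∈ Q, 0 ≤ f x := fun x hx => (hf_pos x hx).le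
    have hg0 : ∀ x ∈ Q, 0 ≤ g x := fun x hx => (hg_pos x hx).le
    have e1 := setIntegral_eq_toReal hQ1 hQ2 hQm hg0 hg_zero hgm hGg MeasurableSet.univ
    have e2 := setIntegral_eq_toReal hQ1 hQ2 hQm hf0 hf_zero hfm hFf MeasurableSet.univ
    have e3 := setIntegral_eq_toReal hQ1 hQ2 hQm hg0 hg_zero hgm hGg hA
    have e4 := setIntegral_eq_toReal hQ1 hQ2 hQm hf0 hf_zero hfm hFf
      ((isClosed_closure (s := Q)).measurableSet.inter (hTm hA))
    simp only [setIntegral_univ, preimage_univ, indicator_univ, Pi.one_apply, one_mul] at e1 e2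
    have e5 : ∫⁻ y, (WithLp.toLp 2 ⁻¹' (closure Q ∩ euclideanKnothe a F G ⁻¹' A)).indicator 1 y *
        F y ∂cubeVolume a =
        ∫⁻ y, (WithLp.toLp 2 ⁻¹' A).indicator 1 (knothe a F G y) * F y ∂cubeVolume a := by
      apply lintegral_congr_ae
      filter_upwards [ae_mem_openCube (a := a)] with y hy
      have hyc : WithLp.toLp 2 y ∈ closure Q := subset_closure (hQ1 _ hy)
      congr 1
      have hiff : y ∈ WithLp.toLp 2 ⁻¹' (closure Q ∩ euclideanKnothe a F G ⁻¹' A) ↔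
          knothe a F G y ∈ WithLp.toLp 2 ⁻¹' A := ⟨fun h => h.2, fun h => ⟨hyc, h⟩⟩
      by_cases hc : knothe a F G y ∈ WithLp.toLp 2 ⁻¹' A
      · rw [indicator_of_mem hc, indicator_of_mem (hiff.2 hc)]
        rfl
      · rw [indicator_of_notMem hc, indicator_of_notMem fun h => hc (hiff.1 h)]
    have key := lintegral_knothe hF hF0 hM hFM hG hG0 hGfin
      (measurable_one.indicator (htoLp hA))
    have key' := congrArg ENNReal.toReal key
    rw [ENNReal.toReal_mul, ENNReal.toReal_mul, ← e5, ← e4, ← e1, ← e3, ← e2] at key'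
    have hgne : ∫ x, g x ≠ 0 := by
      rw [e1]; exact (ENNReal.toReal_pos (lintegral_density_ne_zero hG hG0) hGfin).ne'
    have hfne : ∫ x, f x ≠ 0 := by
      rw [e2]; exact (ENNReal.toReal_pos (lintegral_density_ne_zero hF hF0) hFfin).ne'
    field_simp
    linarith

lemma isKnotheMap_euclideanKnothe (hfm : AEMeasurable f (volume.restrict Q))
    (hgm : AEMeasurable g (volume.restrict Q)) :
    IsKnotheMap f g (euclideanKnothe a F G) := by
  refine ⟨isTransportMap_euclideanKnothe hQ1 hQ2 hQm hf_pos hf_zero hg_pos hg_zero hF hF0 hM hFM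
    hG hG0 hGfin hFf hGg hfm hgm, fun x hx x' hx' i hlt => ?_⟩
  rw [support_eq_of_pos hf_pos hf_zero, mem_closure_cube_iff hQ1 hQ2] at hx hx'
  refine ⟨fun hi => ?_, fun hi => ?_⟩
  · refine knothe_congr i fun j hj => ?_
    rcases eq_or_lt_of_le hj with rfl | hj
    · exact hi
    · exact hlt j hj
  · have h := strictMonoOn_knothe hF hF0 hM hFM hG hG0 i x.ofLp (hx i) (hx' i) hi
    simp only [Function.update_eq_self] at h
    refine h.trans_eq (knothe_congr i fun j hj => ?_)
    rcases eq_or_lt_of_le hj with rfl | hj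
    · simp
    · rw [Function.update_of_ne hj.ne]
      exact hlt j hj

/-- By the change of variables formula, `S_T` is up to the logarithm of the ratio of the masses
the sum of the one-dimensional costs `p (τᵢ - 1 - log τᵢ)` minus a divergence. -/
lemma ae_mapS_eq {p : EuclideanSpace ℝ (Fin n) → ℝ} (hpf : EqOn f p Q)
    (hfm : AEMeasurable f (volume.restrict Q)) (hgm : AEMeasurable g (volume.restrict Q)) :
    ∀ᵐ y ∂cubeVolume a, mapS g f (euclideanKnothe a F G) (WithLp.toLp 2 y) =
      (∑ i, p (WithLp.toLp 2 y) * ((knotheDeriv a F G i y).toReal - 1 -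
        Real.log (knotheDeriv a F G i y).toReal)) +
      (p (WithLp.toLp 2 y) * Real.log ((∫ x in Q, g x) / ∫ x in Q, f x) -
        ∑ i, (fderiv ℝ p (WithLp.toLp 2 y) (EuclideanSpace.single i 1) *
          (knothe a F G y i - y i) +
          p (WithLp.toLp 2 y) * ((knotheDeriv a F G i y).toReal - 1))) := by
  have hFfin : ∫⁻ y, F y ∂cubeVolume a ≠ ⊤ := by
    rw [← marg_zero (0 : Fin n → ℝ)]; exact marg_ne_top hM hFM _ _
  have hf0 : ∀ x ∈ Q, 0 ≤ f x := fun x hx => (hf_pos x hx).le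
  have hg0 : ∀ x ∈ Q, 0 ≤ g x := fun x hx => (hg_pos x hx).le
  have e1 := setIntegral_eq_toReal hQ1 hQ2 hQm hg0 hg_zero hgm hGg MeasurableSet.univ
  have e2 := setIntegral_eq_toReal hQ1 hQ2 hQm hf0 hf_zero hfm hFf MeasurableSet.univ
  simp only [setIntegral_univ, preimage_univ, indicator_univ, Pi.one_apply, one_mul] at e1 e2
  rw [setIntegral_eq_integral_of_forall_compl_eq_zero hf_zero,
    setIntegral_eq_integral_of_forall_compl_eq_zero hg_zero, e1, e2,
    Real.log_div (ENNReal.toReal_pos (lintegral_density_ne_zero hG hG0) hGfin).ne'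
      (ENNReal.toReal_pos (lintegral_density_ne_zero hF hF0) hFfin).ne']
  have hopen : IsOpen {x : EuclideanSpace ℝ (Fin n) | ∀ i, x i ∈ Ioo (a i) (a i + 1)} := by
    have : {x : EuclideanSpace ℝ (Fin n) | ∀ i, x i ∈ Ioo (a i) (a i + 1)} =
        ⋂ i, (fun x => x i) ⁻¹' Ioo (a i) (a i + 1) := by ext; simp
    rw [this]
    exact isOpen_iInter_of_finite fun i => isOpen_Ioo.preimage (by fun_prop)
  have hGgT := (quasiMeasurePreserving_knothe hF hF0 hM hFM hG hG0 hGfin).ae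
    (hGg.and ((ae_cube_iff hQ1 hQ2 (P := fun x => x ∈ Q)).1 (ae_restrict_mem hQm)))
  filter_upwards [ae_mem_openCube (a := a), hFf, hGgT,
    ae_sum_log_knotheDeriv hF hF0 hM hFM hG hG0 hGfin] with y hy hFy hGy hlog
  have hyQ : WithLp.toLp 2 y ∈ Q := hQ1 _ hy
  have hfy := hf_pos _ hyQ
  have hgy := hg_pos _ hGy.2
  rw [hFy, hGy.1, ENNReal.toReal_ofReal hfy.le, ENNReal.toReal_ofReal hgy.le] at hlog
  have hfd : fderiv ℝ f (WithLp.toLp 2 y) = fderiv ℝ p (WithLp.toLp 2 y) := by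
    apply Filter.EventuallyEq.fderiv_eq
    filter_upwards [hopen.mem_nhds (x := WithLp.toLp 2 y) hy] with x hx using hpf (hQ1 x hx)
  have hlin : ∀ v : EuclideanSpace ℝ (Fin n), fderiv ℝ p (WithLp.toLp 2 y) v =
      ∑ i, fderiv ℝ p (WithLp.toLp 2 y) (EuclideanSpace.single i 1) * v i := by
    intro v
    conv_lhs => rw [← (EuclideanSpace.basisFun (Fin n) ℝ).sum_repr v]
    simp [mul_comm]
  have hlog2 : Real.log (g (WithLp.toLp 2 (knothe a F G y)) / f (WithLp.toLp 2 y)) =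
      Real.log (∫⁻ x, G x ∂cubeVolume a).toReal - Real.log (∫⁻ x, F x ∂cubeVolume a).toReal -
        ∑ i, Real.log (knotheDeriv a F G i y).toReal := by
    rw [hlog, Real.log_div hgy.ne' hfy.ne']
    ring
  rw [mapS, pointS, hfd, hlin]
  change f (WithLp.toLp 2 y) * Real.log (g (WithLp.toLp 2 (knothe a F G y)) /
    f (WithLp.toLp 2 y)) - ∑ i, fderiv ℝ p (WithLp.toLp 2 y) (EuclideanSpace.single i 1) *
      (knothe a F G y i - y i) = _
  rw [hlog2, ← hpf hyQ]
  simp only [Finset.sum_add_distrib, ← Finset.mul_sum, Finset.sum_sub_distrib]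
  ring

end Transfer

/-! ### The transportation cost inequality on the cube -/

theorem mainTheorem4 {n : ℕ} (R : ℝ) (hR : 1 ≤ R)
    (Q : Set (EuclideanSpace ℝ (Fin n))) (hQ : IsUnitCube Q)
    -- functions on `Q` are regarded as functions on the whole space that vanish outside `Q`
    (f g : EuclideanSpace ℝ (Fin n) → ℝ)
    (hf_pos : ∀ x ∈ Q, 0 < f x) (hf_zero : ∀ x ∉ Q, f x = 0)
    (hf_lip : ∃ K : NNReal, LipschitzOnWith K f Q)
    (hf_conv : IsApproxConvexAlongAxes R Q f)
    (hg_pos : ∀ x ∈ Q, 0 < g x) (hg_zero : ∀ x ∉ Q, g x = 0)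
    (hg_int : IntegrableOn g Q) :
    ∃ T : EuclideanSpace ℝ (Fin n) → EuclideanSpace ℝ (Fin n),
      IsTransportMap f g T ∧ IsKnotheMap f g T ∧
      IntegralWellDefined Q (mapS g f T) ∧
      ((∫⁻ x in Q, ENNReal.ofReal (‖T x - x‖ ^ 2 * f x) : ENNReal) : EReal) ≤
        ((40 / 9 * R ^ 2 : ℝ) : EReal) *
          (extIntegral Q (mapS g f T) -
            (((∫ x in Q, f x) * Real.log ((∫ x in Q, g x) / ∫ x in Q, f x) : ℝ) : EReal)) ∧
      ((40 / 9 * R ^ 2 : ℝ) : EReal) *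
          (extIntegral Q (mapS g f T) -
            (((∫ x in Q, f x) * Real.log ((∫ x in Q, g x) / ∫ x in Q, f x) : ℝ) : EReal)) ≤
        ((40 / 9 * R ^ 2 : ℝ) : EReal) * Tire g f := by
 
  obtain ⟨hQm, a, hQ1, hQ2⟩ := hQ.exists_corner
  obtain ⟨K, hK⟩ := hf_lip
  -- the globally Lipschitz `p` replaces `f`, which jumps at the boundary of the cube
  obtain ⟨p, hp, hpf⟩ := hK.extend_real
  have hp_pos : ∀ x ∈ Q, 0 < p x := fun x hx => hpf hx ▸ hf_pos x hx
  obtain ⟨F, hF, hF0, ⟨M, hM, hFM⟩, hFp⟩ := exists_bounded_density hQ1 hp.continuous hp_pos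
  obtain ⟨G, hG, hG0, hGg⟩ := exists_positive_density hQ1 hQ2 hQm hg_pos hg_int.aemeasurable
  have hfm : AEMeasurable f (volume.restrict Q) :=
    hp.continuous.aemeasurable.congr <| (ae_restrict_mem hQm).mono fun x hx => (hpf hx).symm
  have hgm := hg_int.aemeasurable
  have hFf : ∀ᵐ y ∂cubeVolume a, F y = ENNReal.ofReal (f (WithLp.toLp 2 y)) := by
    filter_upwards [ae_mem_openCube (a := a)] with y hy
    rw [hFp y hy, hpf (hQ1 _ hy)]
  have hGfin : ∫⁻ x, G x ∂cubeVolume a ≠ ⊤ := by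
    rw [lintegral_congr_ae hGg, ← setLIntegral_cube_eq hQ1 hQ2 fun x => ENNReal.ofReal (g x)]
    exact hg_int.lintegral_lt_top.ne
  have htrans := isTransportMap_euclideanKnothe hQ1 hQ2 hQm hf_pos hf_zero hg_pos hg_zero hF hF0 hM
    hFM hG hG0 hGfin hFf hGg hfm hgm
  have hknothe := isKnotheMap_euclideanKnothe hQ1 hQ2 hQm hf_pos hf_zero hg_pos hg_zero hF hF0 hM
    hFM hG hG0 hGfin hFf hGg hfm hgm
  have hS := ae_mapS_eq hQ1 hQ2 hQm hf_pos hf_zero hg_pos hg_zero hF hF0 hM hFM hG hG0 hGfin hFf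
    hGg hpf hfm hgm
  have htoLp : Measurable (WithLp.toLp 2 : (Fin n → ℝ) → EuclideanSpace ℝ (Fin n)) :=
    (PiLp.volume_preserving_toLp (Fin n)).measurable
  have hpm : Measurable fun y : Fin n → ℝ => p (WithLp.toLp 2 y) :=
    hp.continuous.measurable.comp htoLp
  have hTm : Measurable (knothe a F G) := measurable_knothe hF hF0 hM hFM hG hG0
  have hτm : ∀ i, Measurable fun y => (knotheDeriv a F G i y).toReal := fun i =>
    (measurable_knotheDeriv hF hF0 hM hFM hG hG0 i).ennreal_toReal
  have hτpos := fun i => ae_toReal_knotheDeriv_pos (a := a) hF hF0 hM hFM hG hG0 hGfin i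
  have hac := knothe_eq_integral (a := a) hF hF0 hM hFM hG hG0
  have hφ0 : ∀ᵐ y ∂cubeVolume a, ∀ i, 0 ≤ p (WithLp.toLp 2 y) *
      ((knotheDeriv a F G i y).toReal - 1 - Real.log (knotheDeriv a F G i y).toReal) := by
    filter_upwards [ae_mem_openCube (a := a), ae_all_iff.2 hτpos] with y hy hτ i
    exact mul_nonneg (hp_pos _ (hQ1 _ hy)).le
      (by linarith [Real.log_le_sub_one_of_pos (hτ i)])
  have hφm : ∀ i, Measurable fun y => p (WithLp.toLp 2 y) *
      ((knotheDeriv a F G i y).toReal - 1 - Real.log (knotheDeriv a F G i y).toReal) := fun i =>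
    hpm.mul (((hτm i).sub_const 1).sub (hτm i).log)
  have hB : ∀ y : Fin n → ℝ, (∀ j, y j ∈ Ioo (a j) (a j + 1)) →
      |p (WithLp.toLp 2 y)| ≤ M.toReal := by
    intro y hy
    have h1 := hp_pos _ (hQ1 _ hy)
    rw [abs_of_pos h1, ← ENNReal.toReal_ofReal h1.le, ← hFp y hy]
    exact ENNReal.toReal_mono hM (hFM y)
  have hdiv := fun i => integral_divergence hp hTm hτm (fun i x => (hac i x).1)
    (fun i x => (hac i x).2.1) (fun i x => (hac i x).2.2)
    (fun i x hx => knothe_mem hF hF0 hM hFM hG hG0 hx) (fun i x => ENNReal.toReal_nonneg) i hB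
  have hcost := fun i => lintegral_coord_sq_le hp hTm hτm (fun i x => (hac i x).1)
    (fun i x => (hac i x).2.1) (fun i x => (hac i x).2.2)
    (fun i x hx => knothe_mem hF hF0 hM hFM hG hG0 hx) hR i
    (fun y hy => (hp_pos _ (hQ1 _ hy)).le) (by
      intro y hy s hs t ht l hl0 hl1
      have hmem : ∀ r ∈ Ioo (a i) (a i + 1), WithLp.toLp 2 (Function.update y i r) ∈ Q := by
        intro r hr
        refine hQ1 _ fun j => ?_
        rcases eq_or_ne j i with rfl | hne
        · simpa using hr
        · simpa [hne] using hy j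
      have hcomb : l • WithLp.toLp 2 (Function.update y i s) +
          (1 - l) • WithLp.toLp 2 (Function.update y i t) =
          WithLp.toLp 2 (Function.update y i (l * s + (1 - l) * t)) := by
        ext j
        rcases eq_or_ne j i with rfl | hne
        · simp
        · simp only [PiLp.add_apply, PiLp.smul_apply, Function.update_of_ne hne, smul_eq_mul]
          ring
      have hlt : l * s + (1 - l) * t ∈ Ioo (a i) (a i + 1) :=
        (convex_Ioo (a i) (a i + 1)) hs ht hl0.le (by linarith) (by ring)
      have h := hf_conv _ (hmem s hs) _ (hmem t ht) ⟨i, s - t, by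
        ext j
        rcases eq_or_ne j i with rfl | hne
        · simp
        · simp [hne]⟩ l hl0 hl1
      rwa [hcomb, hpf (hmem _ hlt), hpf (hmem s hs), hpf (hmem t ht)] at h) (hτpos i)
  -- `p` is integrated over the open cube, which carries the whole mass of `f`
  have hpi : Integrable (fun y : Fin n → ℝ => p (WithLp.toLp 2 y)) (cubeVolume a) := by
    refine Integrable.of_bound hpm.aestronglyMeasurable M.toReal ?_
    filter_upwards [ae_mem_openCube (a := a)] with y hy using hB y hy
  have hmass : ∫ y, p (WithLp.toLp 2 y) ∂cubeVolume a = ∫ x in Q, f x := by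
    have h := setIntegral_eq_toReal hQ1 hQ2 hQm (fun x hx => (hf_pos x hx).le) hf_zero hfm hFf .univ
    rw [setIntegral_univ] at h
    rw [setIntegral_eq_integral_of_forall_compl_eq_zero hf_zero, h, integral_eq_lintegral_of_nonneg_ae _ hpm.aestronglyMeasurable]
    · congr 1
      apply lintegral_congr_ae
      filter_upwards [ae_mem_openCube (a := a)] with y hy
      simp [hFp y hy]
    · filter_upwards [ae_mem_openCube (a := a)] with y hy using (hp_pos _ (hQ1 _ hy)).le
  set L : ℝ := Real.log ((∫ x in Q, g x) / ∫ x in Q, f x) with hL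
  have hBi : Integrable (fun y => p (WithLp.toLp 2 y) * L -
      ∑ i, (fderiv ℝ p (WithLp.toLp 2 y) (EuclideanSpace.single i 1) * (knothe a F G y i - y i) +
        p (WithLp.toLp 2 y) * ((knotheDeriv a F G i y).toReal - 1))) (cubeVolume a) :=
    (hpi.mul_const L).sub (integrable_finsetSum _ fun i _ => (hdiv i).1)
  have hBint : ∫ y, (p (WithLp.toLp 2 y) * L -
      ∑ i, (fderiv ℝ p (WithLp.toLp 2 y) (EuclideanSpace.single i 1) * (knothe a F G y i - y i) +
        p (WithLp.toLp 2 y) * ((knotheDeriv a F G i y).toReal - 1))) ∂cubeVolume a =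
      (∫ x in Q, f x) * L := by
    rw [integral_sub (hpi.mul_const L) (integrable_finsetSum _ fun i _ => (hdiv i).1),
      integral_finsetSum _ fun i _ => (hdiv i).1, integral_mul_const, hmass]
    simp [(hdiv _).2]
  have hAm : Measurable fun y => ∑ i, p (WithLp.toLp 2 y) *
      ((knotheDeriv a F G i y).toReal - 1 - Real.log (knotheDeriv a F G i y).toReal) :=
    Finset.measurable_fun_sum _ fun i _ => hφm i
  obtain ⟨hneg, hext⟩ := lintegral_sub_lintegral_neg_eq hS
    (hφ0.mono fun y hy => Finset.sum_nonneg fun i _ => hy i) hAm.aemeasurable hBi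
  -- the correction term `(∫ f) log (∫ g / ∫ f)` cancels the integral of the integrable part
  have hextQ : extIntegral Q (mapS g f (euclideanKnothe a F G)) -
      (((∫ x in Q, f x) * L : ℝ) : EReal) =
      ((∫⁻ y, ENNReal.ofReal (∑ i, p (WithLp.toLp 2 y) * ((knotheDeriv a F G i y).toReal - 1 -
        Real.log (knotheDeriv a F G i y).toReal)) ∂cubeVolume a : ENNReal) : EReal) := by
    rw [extIntegral,
      setLIntegral_cube_eq hQ1 hQ2 fun x => ENNReal.ofReal (mapS g f (euclideanKnothe a F G) x),
      setLIntegral_cube_eq hQ1 hQ2 fun x => ENNReal.ofReal (-mapS g f (euclideanKnothe a F G) x),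
      hext, hBint]
    exact EReal.add_sub_cancel_right
  have hwd : IntegralWellDefined Q (mapS g f (euclideanKnothe a F G)) := by
    refine ⟨?_, Or.inr ?_⟩
    · have hofLp : AEMeasurable (WithLp.ofLp : EuclideanSpace ℝ (Fin n) → (Fin n → ℝ))
          (volume.restrict Q) := (PiLp.volume_preserving_ofLp (Fin n)).measurable.aemeasurable
      have hmp := measurePreserving_ofLp_cube hQ1 hQ2
      have hm := (hAm.aemeasurable.add hBi.aemeasurable).comp_quasiMeasurePreserving
        hmp.quasiMeasurePreserving
      exact hm.congr (((ae_cube_iff hQ1 hQ2 (P := fun x =>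
        mapS g f (euclideanKnothe a F G) x = _)).2 hS).mono fun x hx => hx.symm)
    · rwa [setLIntegral_cube_eq hQ1 hQ2
        fun x => ENNReal.ofReal (-mapS g f (euclideanKnothe a F G) x)]
  have hc0 : (0 : EReal) ≤ ((40 / 9 * R ^ 2 : ℝ) : EReal) := EReal.coe_nonneg.2 (by positivity)
  refine ⟨euclideanKnothe a F G, htrans, hknothe, hwd, ?_, ?_⟩
  · have hconst : ((40 / 9 * R ^ 2 : ℝ) : EReal) =
        ((ENNReal.ofReal (40 / 9 * R ^ 2) : ENNReal) : EReal) := by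
      rw [EReal.coe_ennreal_ofReal, max_eq_left (by positivity)]
    rw [hextQ, hconst, ← EReal.coe_ennreal_mul, EReal.coe_ennreal_le_coe_ennreal_iff,
      setLIntegral_cube_eq hQ1 hQ2
        fun x => ENNReal.ofReal (‖euclideanKnothe a F G x - x‖ ^ 2 * f x)]
    have e1 : ∫⁻ y, ENNReal.ofReal (‖euclideanKnothe a F G (WithLp.toLp 2 y) -
        WithLp.toLp 2 y‖ ^ 2 * f (WithLp.toLp 2 y)) ∂cubeVolume a =
        ∑ i, ∫⁻ y, ENNReal.ofReal ((knothe a F G y i - y i) ^ 2 * p (WithLp.toLp 2 y))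
          ∂cubeVolume a := by
      have hm : ∀ i, Measurable fun y =>
          ENNReal.ofReal ((knothe a F G y i - y i) ^ 2 * p (WithLp.toLp 2 y)) := fun i =>
        (((((measurable_pi_apply i).comp hTm).sub
          (measurable_pi_apply i)).pow_const 2).mul hpm).ennreal_ofReal
      rw [← lintegral_finsetSum _ fun i _ => hm i]
      apply lintegral_congr_ae
      filter_upwards [ae_mem_openCube (a := a)] with y hy
      have hpy := hp_pos _ (hQ1 _ hy)
      rw [← ENNReal.ofReal_sum_of_nonneg fun i _ => mul_nonneg (sq_nonneg _) hpy.le,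
        ← Finset.sum_mul, EuclideanSpace.norm_sq_eq, hpf (hQ1 _ hy)]
      simp [euclideanKnothe]
    have e2 : ∫⁻ y, ENNReal.ofReal (∑ i, p (WithLp.toLp 2 y) *
        ((knotheDeriv a F G i y).toReal - 1 - Real.log (knotheDeriv a F G i y).toReal))
          ∂cubeVolume a = ∑ i, ∫⁻ y, ENNReal.ofReal (p (WithLp.toLp 2 y) *
        ((knotheDeriv a F G i y).toReal - 1 - Real.log (knotheDeriv a F G i y).toReal))
          ∂cubeVolume a := by
      rw [← lintegral_finsetSum _ fun i _ => (hφm i).ennreal_ofReal]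
      apply lintegral_congr_ae
      filter_upwards [hφ0] with y hy
      exact ENNReal.ofReal_sum_of_nonneg fun i _ => hy i
    rw [e1, e2, Finset.mul_sum]
    -- the constant of the one-dimensional inequality is `4`, and `4 ≤ 40 / 9`
    refine Finset.sum_le_sum fun i _ => (hcost i).trans ?_
    gcongr
    norm_num
  · refine mul_le_mul_of_nonneg_left ?_ hc0
    have hsupp := support_eq_of_pos hf_pos hf_zero
    rw [hL, setIntegral_eq_integral_of_forall_compl_eq_zero hf_zero,
      setIntegral_eq_integral_of_forall_compl_eq_zero hg_zero, Tire, hsupp]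
    exact le_iSup₂_of_le (euclideanKnothe a F G) ⟨htrans, hwd⟩ le_rfl
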